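/- Let $\gamma_1,\gamma_2\in(-1,-1/2)$ with $\gamma_1+\gamma_2>-3/2$, let $A\in\mathbb R$, and let $B$ be a Brownian random measure on $\mathbb R$, that is, a centered Gaussian family $(B(S))$ indexed by the Borel sets $S\subset\mathbb R$ of finite Lebesgue measure with $\mathbb E[B(S)B(T)]=|S\cap T|$. Then the kernel $$f(x_1,x_2)=\frac A2\int_0^1\big[(s-x_1)_+^{\gamma_1}(s-x_2)_+^{\gamma_2}+(s-x_1)_+^{\gamma_2}(s-x_2)_+^{\gamma_1}\big]\,ds$$ (where $u_+^{\gamma}=u^\gamma$ for $u>0$ and $u_+^\gamma=0$ for $u\le 0$) is defined for almost every $(x_1,x_2)\in\mathbb R^2$ and belongs to $L^2(\mathbb R^2)$, so that the double Wiener–Itô integral $$Z_{\gamma_1,\gamma_2}(1)=\int_{\mathbb R^2}' f(x_1,x_2)\,B(dx_1)\,B(dx_2)$$ (diagonals excluded), the generalized Rosenblatt variable, exists. It has finite second and third moments. With $\mathrm B(x,y)=\int_0^1u^{x-1}(1-u)^{y-1}\,du=\Gamma(x)\Gamma(y)/\Gamma(x+y)$ for $x,y>0$, its second moment is $$\mu_2(\gamma_1,\gamma_2)=\frac{A^2}{(\gamma_1+\gamma_2+2)(2(\gamma_1+\gamma_2)+3)}\Big[\mathrm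 B(\gamma_1+1,-\gamma_1-\gamma_2-1)\,\mathrm B(\gamma_2+1,-\gamma_1-\gamma_2-1)+\mathrm B(\gamma_1+1,-2\gamma_1-1)\,\mathrm B(\gamma_2+1,-2\gamma_2-1)\Big],$$ and its third moment is $$\mu_3(\gamma_1,\gamma_2)=\frac{2A^3}{(\gamma_1+\gamma_2+2)(3(\gamma_1+\gamma_2)+5)}\sum_{\sigma\in\{1,2\}^3}\mathrm B(\gamma_{\sigma_1}+1,-\gamma_{\sigma_1}-\gamma_{\sigma_3'}-1)\,\mathrm B(\gamma_{\sigma_1'}+1,-\gamma_{\sigma_1'}-\gamma_{\sigma_2}-1)\,\mathrm B(\gamma_{\sigma_2'}+1,-\gamma_{\sigma_2'}-\gamma_{\sigma_3}-1)\,\mathrm B(\gamma_{\sigma_1'}+\gamma_{\sigma_2}+2,\gamma_{\sigma_2'}+\gamma_{\sigma_3}+2),$$ where $\sigma=(\sigma_1,\sigma_2,\sigma_3)$ and $\sigma_i'=3-\sigma_i$. -/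

import Mathlib

open MeasureTheory ProbabilityTheory Filter Topology Set

noncomputable section

/-- Borel subsets of the real line with finite Lebesgue measure. -/
def FiniteBorel : Type := {S : Set ℝ // MeasurableSet S ∧ volume S ≠ ⊤}

/-- A Brownian random measure on the real line (Gaussian white noise with Lebesgue control
measure): a centered Gaussian family `B S`, indexed by the Borel sets of finite measure, with
`E[B S * B T] = volume (S ∩ T)`. -/
structure IsBrownianRandomMeasure {Ω : Type*} [MeasurableSpace Ω] (P : Measure Ω)
    (B : FiniteBorel → Ω → ℝ) : Prop where
  gaussian : IsGaussianProcess B P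
  mean_zero : ∀ S : FiniteBorel, ∫ ω, B S ω ∂P = 0
  covariance : ∀ S T : FiniteBorel, ∫ ω, B S ω * B T ω ∂P = volume.real (S.1 ∩ T.1)

/-- The data of an elementary integrand `∑ i j, coeff i j * 1_{set i × set j}`, with pairwise
disjoint sets of finite measure and with coefficients that vanish on the diagonal. -/
structure OffDiagSimple where
  n : ℕ
  set : Fin n → FiniteBorel
  disjoint : ∀ i j, i ≠ j → Disjoint (set i).1 (set j).1
  coeff : Fin n → Fin n → ℝ
  coeff_diag : ∀ i, coeff i i = 0

namespace OffDiagSimple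

/-- The elementary integrand as a function on the plane. -/
def toFun (φ : OffDiagSimple) (x : ℝ × ℝ) : ℝ :=
  ∑ i, ∑ j, φ.coeff i j *
    ((φ.set i).1.indicator (fun _ => (1 : ℝ)) x.1 * (φ.set j).1.indicator (fun _ => (1 : ℝ)) x.2)

/-- The double Wiener–Itô integral of an elementary integrand. -/
def integral {Ω : Type*} (φ : OffDiagSimple) (B : FiniteBorel → Ω → ℝ) (ω : Ω) : ℝ :=
  ∑ i, ∑ j, φ.coeff i j * (B (φ.set i) ω * B (φ.set j) ω)

end OffDiagSimple

/-- `Z` is (a version of) the double Wiener–Itô integral of `f ∈ L²(ℝ²)` with respect to `B`,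
diagonals excluded: the limit in `L²(P)` of the integrals of elementary integrands that converge
to `f` in `L²(ℝ²)`. -/
def IsDoubleWienerIto {Ω : Type*} [MeasurableSpace Ω] (P : Measure Ω)
    (B : FiniteBorel → Ω → ℝ) (f : ℝ × ℝ → ℝ) (Z : Ω → ℝ) : Prop :=
  MemLp f 2 volume ∧ MemLp Z 2 P ∧
    ∃ φ : ℕ → OffDiagSimple,
      Tendsto (fun k => eLpNorm (fun x => (φ k).toFun x - f x) 2 volume) atTop (𝓝 0) ∧
      Tendsto (fun k => eLpNorm (fun ω => (φ k).integral B ω - Z ω) 2 P) atTop (𝓝 0)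

/-- The power of the positive part, `u_+ ^ γ`, which is zero for `u ≤ 0`. -/
def posPow (u γ : ℝ) : ℝ := if 0 < u then u ^ γ else 0

/-- `(s - x₁)_+^{γ₁} (s - x₂)_+^{γ₂} + (s - x₁)_+^{γ₂} (s - x₂)_+^{γ₁}`. -/
def rosenblattIntegrand (γ₁ γ₂ : ℝ) (x : ℝ × ℝ) (s : ℝ) : ℝ :=
  posPow (s - x.1) γ₁ * posPow (s - x.2) γ₂ + posPow (s - x.1) γ₂ * posPow (s - x.2) γ₁

/-- The kernel of the generalized Rosenblatt process at time `t`. -/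
def rosenblattKernel (A γ₁ γ₂ t : ℝ) (x : ℝ × ℝ) : ℝ :=
  A / 2 * ∫ s in (0 : ℝ)..t, rosenblattIntegrand γ₁ γ₂ x s

/-- `Z` is (a version of) the generalized Rosenblatt process at time `t`, driven by `B`. -/
def IsGenRosenblatt {Ω : Type*} [MeasurableSpace Ω] (P : Measure Ω)
    (B : FiniteBorel → Ω → ℝ) (A γ₁ γ₂ t : ℝ) (Z : Ω → ℝ) : Prop :=
  IsDoubleWienerIto P B (rosenblattKernel A γ₁ γ₂ t) Z

end

/-! ### Moments of quadratic forms in Gaussian vectors -/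

/-! On an elementary integrand with matrix `M` the double integral is a quadratic form in a Gaussian
vector whose covariance is the Gram matrix `C` of the indicators, and the exclusion of diagonals
gives `tr (M C) = 0`. With `M` made symmetric, diagonalizing `√C M √C` turns the form into `∑ λᵢ
(ηᵢ² - 1)`, the `ηᵢ` independent standard Gaussians, so its second and third moments are `2 ∑ λᵢ²`
and `8 ∑ λᵢ³`. These are traces of powers of `M C`, that is, `2 ∫ g²` and `8 ∫ g(x,y) g(y,z) g(z,x)`
for the symmetrized kernel `g` (`moments_quadForm_tensorSum`).

Elementary integrands are dense in `L²`, and the second moment formula makes the integral a bounded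
map, so the double integral exists. Both formulas survive the `L²` limit: on the kernel side by
Cauchy–Schwarz (`tendsto_cyclicIntegral`), on the random side because the fourth moments are at most
`60 (∫ g²)²`, uniformly along the sequence (`tendsto_integral_cube`).

The Rosenblatt kernel is `A / 2` times a nonnegative function, so both integrals are computed by
Tonelli in `ENNReal`. Integrating out the space variables leaves `L²` inner products of shifted
powers, each a Beta value times a power of the time gap (`posPowInner_eq`). Every index occurs
together with its complement, so the total exponent depends only on `γ 0 + γ 1`. By symmetry in the
times it is enough to treat ordered times, with a factor 2 or 6. In the third moment the middle time
contributes the last Beta factor. What remains is the integral of `(t - s) ^ (p - 1)` over `0 < s <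
t < 1`, equal to `1 / (p (p + 1))`; for the second moment `p = 2 (γ 0 + γ 1) + 3`, which is positive
by the assumption on the sum. -/

theorem integral_pow_two_mul_gaussianReal (k : ℕ) :
    ∫ x, x ^ (2 * k) ∂(gaussianReal 0 1) = (Nat.doubleFactorial (2 * k - 1) : ℝ) := by
  rw [integral_gaussianReal_eq_integral_smul one_ne_zero]
  -- The integrand is even: written as a function of `|x|`, its integral is twice a half-line
  -- integral, which is a Gamma value.
  have h1 : ∀ x : ℝ, gaussianPDFReal 0 1 x • x ^ (2 * k) =
      (fun y : ℝ => (√(2 * Real.pi))⁻¹ * (y ^ ((2 * k : ℕ) : ℝ) *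
        Real.exp (-(1 / 2) * y ^ (2 : ℝ)))) |x| := by
    intro x
    simp only [gaussianPDFReal, smul_eq_mul, NNReal.coe_one, mul_one, sub_zero, Real.rpow_natCast,
      Real.rpow_two, sq_abs]
    rw [pow_mul |x|, sq_abs, ← pow_mul]
    ring_nf
  simp_rw [h1]
  rw [integral_comp_abs (f := fun y : ℝ => (√(2 * Real.pi))⁻¹ * (y ^ ((2 * k : ℕ) : ℝ) *
        Real.exp (-(1 / 2) * y ^ (2 : ℝ)))), integral_const_mul,
    integral_rpow_mul_exp_neg_mul_rpow (by norm_num) (lt_of_lt_of_le (by norm_num)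
      (Nat.cast_nonneg _)) (by norm_num)]
  have h2 : (((2 * k : ℕ) : ℝ) + 1) / 2 = k + 1 / 2 := by push_cast; ring
  rw [h2, Real.Gamma_nat_add_half]
  have h3 : (1 / 2 : ℝ) ^ (-(((2 * k : ℕ) : ℝ) + 1) / 2) = 2 ^ k * √2 := by
    rw [neg_div, h2, one_div, Real.inv_rpow (by norm_num), Real.rpow_neg (by norm_num), inv_inv,
      Real.rpow_add (by norm_num), Real.rpow_natCast, ← one_div, Real.sqrt_eq_rpow]
  rw [h3, Real.sqrt_mul (by norm_num)]
  have := Real.sqrt_ne_zero'.2 Real.pi_pos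
  have := Real.sqrt_ne_zero'.2 (by norm_num : (0 : ℝ) < 2)
  field_simp

theorem integrable_pow_gaussianReal (n : ℕ) :
    Integrable (fun x : ℝ => x ^ n) (gaussianReal 0 1) := by
  rcases n.eq_zero_or_pos with rfl | h
  · simp
  · have := (memLp_id_gaussianReal' (μ := 0) (v := 1) n (by simp)).integrable_norm_pow h.ne'
    refine (integrable_norm_iff (by fun_prop)).1 (this.congr ?_)
    simp

/-- The first four moments of a sum of independent random variables that have the first four
moments of `lam i * (η ^ 2 - 1)`, `η` standard Gaussian. -/
theorem moments_sum_of_iIndepFun {Ω ι : Type*} [MeasurableSpace Ω] {P : Measure Ω}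
    [IsProbabilityMeasure P] {Y : ι → Ω → ℝ} (hind : iIndepFun Y P) (hm : ∀ i, Measurable (Y i))
    (hint : ∀ i n, Integrable (fun ω => Y i ω ^ n) P) (lam : ι → ℝ)
    (h1 : ∀ i, ∫ ω, Y i ω ∂P = 0) (h2 : ∀ i, ∫ ω, Y i ω ^ 2 ∂P = 2 * lam i ^ 2)
    (h3 : ∀ i, ∫ ω, Y i ω ^ 3 ∂P = 8 * lam i ^ 3) (h4 : ∀ i, ∫ ω, Y i ω ^ 4 ∂P = 60 * lam i ^ 4)
    (s : Finset ι) :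
    (∀ n, Integrable (fun ω => (∑ i ∈ s, Y i ω) ^ n) P) ∧
    ∫ ω, (∑ i ∈ s, Y i ω) ∂P = 0 ∧
    ∫ ω, (∑ i ∈ s, Y i ω) ^ 2 ∂P = 2 * ∑ i ∈ s, lam i ^ 2 ∧
    ∫ ω, (∑ i ∈ s, Y i ω) ^ 3 ∂P = 8 * ∑ i ∈ s, lam i ^ 3 ∧
    ∫ ω, (∑ i ∈ s, Y i ω) ^ 4 ∂P ≤ 60 * (∑ i ∈ s, lam i ^ 2) ^ 2 := by
  classical
  induction s using Finset.induction_on with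
  | empty =>
    refine ⟨fun n => by simp, by simp, by simp, by simp, by simp⟩
  | insert i s hi ih =>
    obtain ⟨hS, e1, e2, e3, e4⟩ := ih
    simp_rw [Finset.sum_insert hi]
    have hI : IndepFun (fun ω => ∑ j ∈ s, Y j ω) (Y i) P := by
      have := hind.indepFun_finsetSum_of_notMem hm hi
      convert this using 1
      ext ω; simp
    have hSm : Measurable (fun ω => ∑ j ∈ s, Y j ω) := by fun_prop
    set S := fun ω => ∑ j ∈ s, Y j ω with hSdef
    have hIab : ∀ a b : ℕ, IndepFun (fun ω => S ω ^ a) (fun ω => Y i ω ^ b) P := fun a b =>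
      hI.comp (φ := fun x => x ^ a) (ψ := fun x => x ^ b) (by fun_prop) (by fun_prop)
    have hprod : ∀ a b : ℕ, Integrable (fun ω => S ω ^ a * Y i ω ^ b) P := fun a b =>
      (hIab a b).integrable_mul (hS a) (hint i b)
    have hmul : ∀ a b : ℕ, ∫ ω, S ω ^ a * Y i ω ^ b ∂P =
        (∫ ω, S ω ^ a ∂P) * ∫ ω, Y i ω ^ b ∂P := fun a b =>
      (hIab a b).integral_fun_mul_eq_mul_integral (hS a).1 (hint i b).1
    have hpow : ∀ n, (fun ω => (Y i ω + S ω) ^ n) =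
        fun ω => ∑ m ∈ Finset.range (n + 1), (n.choose m : ℝ) * (S ω ^ m * Y i ω ^ (n - m)) := by
      intro n; ext ω
      rw [add_comm, add_pow]
      exact Finset.sum_congr rfl fun _ _ => by ring
    have hint' : ∀ n, ∫ ω, (Y i ω + S ω) ^ n ∂P = ∑ m ∈ Finset.range (n + 1), (n.choose m : ℝ) *
        ((∫ ω, S ω ^ m ∂P) * ∫ ω, Y i ω ^ (n - m) ∂P) := by
      intro n
      rw [hpow, integral_finsetSum _ fun m _ => (hprod _ _).const_mul _]
      simp_rw [integral_const_mul, hmul]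
    have hs0 : 0 ≤ ∑ i ∈ s, lam i ^ 2 := Finset.sum_nonneg fun _ _ => sq_nonneg _
    have e1' : ∫ ω, S ω ∂P = 0 := e1
    have e2' : ∫ ω, S ω ^ 2 ∂P = _ := e2
    have e3' : ∫ ω, S ω ^ 3 ∂P = _ := e3
    refine ⟨fun n => ?_, ?_, ?_, ?_, ?_⟩
    · change Integrable (fun ω => (Y i ω + S ω) ^ n) P
      rw [hpow]
      exact integrable_finsetSum _ fun m _ => (hprod _ _).const_mul _
    · have := hint' 1
      simp only [pow_one] at this
      rw [show (∫ ω, Y i ω + ∑ j ∈ s, Y j ω ∂P) = ∫ ω, (Y i ω + S ω) ∂P from rfl, this]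
      simp [Finset.sum_range_succ, e1', h1]
    · change ∫ ω, (Y i ω + S ω) ^ 2 ∂P = _
      rw [hint']
      simp [Finset.sum_range_succ, e1', h1, e2', h2]
      ring
    · change ∫ ω, (Y i ω + S ω) ^ 3 ∂P = _
      rw [hint']
      simp [Finset.sum_range_succ, e1', h1, e2', h2, e3', h3]
      ring
    · change ∫ ω, (Y i ω + S ω) ^ 4 ∂P ≤ _
      rw [hint']
      simp [Finset.sum_range_succ, e1', h1, e2', h2, e3', h3, h4]
      have e4' : ∫ ω, S ω ^ 4 ∂P ≤ _ := e4
      norm_num [Nat.choose]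
      -- With `q` the sum over `s`, the binomial terms containing a first moment vanish, leaving at
      -- most `60 q² + 6 (2 q) (2 λ²) + 60 λ⁴`; since `24 ≤ 120` this is below `60 (q + λ²)²`.
      nlinarith [mul_nonneg hs0 (sq_nonneg (lam i))]

open Matrix in
/-- The moments of a traceless quadratic form in a standard Gaussian vector. -/
theorem moments_dotProduct_mulVec_stdGaussian {ι : Type*} [Fintype ι] [DecidableEq ι]
    (N : Matrix ι ι ℝ) (hN : N.IsHermitian) (htr : N.trace = 0) :
    (∀ n, Integrable (fun x : EuclideanSpace ℝ ι => (x ⬝ᵥ N *ᵥ x) ^ n)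
      (stdGaussian (EuclideanSpace ℝ ι))) ∧
    ∫ x : EuclideanSpace ℝ ι, (x ⬝ᵥ N *ᵥ x) ^ 2 ∂(stdGaussian (EuclideanSpace ℝ ι)) =
      2 * (N * N).trace ∧
    ∫ x : EuclideanSpace ℝ ι, (x ⬝ᵥ N *ᵥ x) ^ 3 ∂(stdGaussian (EuclideanSpace ℝ ι)) =
      8 * (N * N * N).trace ∧
    ∫ x : EuclideanSpace ℝ ι, (x ⬝ᵥ N *ᵥ x) ^ 4 ∂(stdGaussian (EuclideanSpace ℝ ι)) ≤
      60 * (N * N).trace ^ 2 := by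
  set lam := hN.eigenvalues with hlam
  have hspec : N = (hN.eigenvectorUnitary : Matrix ι ι ℝ) * diagonal lam *
      (star (hN.eigenvectorUnitary : Matrix ι ι ℝ)) := by
    have := hN.spectral_theorem
    rw [Unitary.conjStarAlgAut_apply] at this
    simpa using! this
  have hUU : (star (hN.eigenvectorUnitary : Matrix ι ι ℝ)) *
      (hN.eigenvectorUnitary : Matrix ι ι ℝ) = 1 := Unitary.coe_star_mul_self _
  set U := (hN.eigenvectorUnitary : Matrix ι ι ℝ) with hU
  have key : ∀ D : Matrix ι ι ℝ, (U * D * star U).trace = D.trace := fun D => by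
    rw [trace_mul_comm, ← mul_assoc, hUU, one_mul]
  have hmul : ∀ D E : Matrix ι ι ℝ, (U * D * star U) * (U * E * star U) = U * (D * E) * star U :=
    fun D E => by
      rw [show (U * D * star U) * (U * E * star U) = U * D * (star U * U) * E * star U by
        simp only [mul_assoc], hUU, mul_one]
      simp only [mul_assoc]
  have t1 : ∑ i, lam i = 0 := by
    rw [hspec, key, trace_diagonal] at htr; exact htr
  have t2 : (N * N).trace = ∑ i, lam i ^ 2 := by
    rw [hspec, hmul, key, diagonal_mul_diagonal, trace_diagonal]
    simp [sq]
  have t3 : (N * N * N).trace = ∑ i, lam i ^ 3 := by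
    rw [hspec, hmul, hmul, key, diagonal_mul_diagonal, diagonal_mul_diagonal, trace_diagonal]
    exact Finset.sum_congr rfl fun _ _ => by ring
  rw [t2, t3]
  have hmap := stdGaussian_eq_map_pi_orthonormalBasis hN.eigenvectorBasis
  -- In eigencoordinates the form is `∑ λᵢ yᵢ²`; the vanishing trace `∑ λᵢ = 0` allows each square
  -- to be centered at no cost.
  have hq : ∀ y : ι → ℝ,
      ((∑ i, y i • hN.eigenvectorBasis i : EuclideanSpace ℝ ι) ⬝ᵥ
        N *ᵥ (∑ i, y i • hN.eigenvectorBasis i : EuclideanSpace ℝ ι)) =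
      ∑ i, lam i * (y i ^ 2 - 1) := by
    intro y
    have hx : (⇑(∑ i, y i • hN.eigenvectorBasis i : EuclideanSpace ℝ ι) : ι → ℝ) = U *ᵥ y := by
      ext j
      simp [Matrix.mulVec, dotProduct, hU, mul_comm]
    have : (U *ᵥ y) ⬝ᵥ (N *ᵥ (U *ᵥ y)) = y ⬝ᵥ (diagonal lam *ᵥ y) := by
      have hs : (U *ᵥ y) = y ᵥ* (star U) := by
        rw [star_eq_conjTranspose, conjTranspose_eq_transpose_of_trivial, vecMul_transpose]
      rw [mulVec_mulVec]
      conv_lhs => rw [hs]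
      rw [← dotProduct_mulVec, mulVec_mulVec, ← mul_assoc, hspec,
        show star U * (U * diagonal lam * star U) * U =
          (star U * U) * diagonal lam * (star U * U) by simp only [mul_assoc], hUU]
      simp
    rw [hx, this]
    simp only [mul_sub, Finset.sum_sub_distrib, mul_one, t1, sub_zero, dotProduct, mulVec_diagonal]
    exact Finset.sum_congr rfl fun _ _ => by ring
  have hmeas : Measurable (fun y : ι → ℝ =>
      (∑ i, y i • hN.eigenvectorBasis i : EuclideanSpace ℝ ι)) := by fun_prop
  have hcont : Continuous (fun x : EuclideanSpace ℝ ι => (x ⬝ᵥ N *ᵥ x)) := by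
    unfold dotProduct mulVec dotProduct
    fun_prop
  have hcp : ∀ n : ℕ, Continuous (fun x : EuclideanSpace ℝ ι => (x ⬝ᵥ N *ᵥ x) ^ n) :=
    fun n => hcont.pow n
  have hind : iIndepFun (fun i (y : ι → ℝ) => lam i * (y i ^ 2 - 1))
      (Measure.pi fun _ : ι => gaussianReal 0 1) :=
    iIndepFun_pi (X := fun i x => lam i * (x ^ 2 - 1)) (fun i => by fun_prop)
  have hp : ∀ k, Integrable (fun x : ℝ => (x ^ 2 - 1) ^ k) (gaussianReal 0 1) := by
    intro k
    simp_rw [sub_eq_add_neg, add_pow, ← pow_mul]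
    exact integrable_finsetSum _ fun m _ =>
      ((integrable_pow_gaussianReal _).mul_const _).mul_const _
  -- The term `m = 0` relies on truncated subtraction: the double factorial is taken at `2 * 0 - 1 =
  -- 0` and equals 1, the zeroth moment.
  have hc : ∀ k, ∫ x : ℝ, (x ^ 2 - 1) ^ k ∂(gaussianReal 0 1) = ∑ m ∈ Finset.range (k + 1),
      (Nat.doubleFactorial (2 * m - 1) : ℝ) * (-1) ^ (k - m) * (k.choose m : ℝ) := by
    intro k
    simp_rw [sub_eq_add_neg, add_pow, ← pow_mul]
    rw [integral_finsetSum _ fun m _ =>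
      ((integrable_pow_gaussianReal _).mul_const _).mul_const _]
    simp_rw [integral_mul_const, integral_pow_two_mul_gaussianReal]
  have c1 : ∫ x : ℝ, (x ^ 2 - 1) ^ 1 ∂(gaussianReal 0 1) = 0 := by
    rw [hc]; norm_num [Finset.sum_range_succ, Nat.doubleFactorial, Nat.choose]
  have c2 : ∫ x : ℝ, (x ^ 2 - 1) ^ 2 ∂(gaussianReal 0 1) = 2 := by
    rw [hc]; norm_num [Finset.sum_range_succ, Nat.doubleFactorial, Nat.choose]
  have c3 : ∫ x : ℝ, (x ^ 2 - 1) ^ 3 ∂(gaussianReal 0 1) = 8 := by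
    rw [hc]; norm_num [Finset.sum_range_succ, Nat.doubleFactorial, Nat.choose]
  have c4 : ∫ x : ℝ, (x ^ 2 - 1) ^ 4 ∂(gaussianReal 0 1) = 60 := by
    rw [hc]; norm_num [Finset.sum_range_succ, Nat.doubleFactorial, Nat.choose]
  have hpi : ∀ (i : ι) (k : ℕ), ∫ y : ι → ℝ, (lam i * (y i ^ 2 - 1)) ^ k
      ∂(Measure.pi fun _ : ι => gaussianReal 0 1) =
      lam i ^ k * ∫ x : ℝ, (x ^ 2 - 1) ^ k ∂(gaussianReal 0 1) := by
    intro i k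
    simp_rw [mul_pow]
    rw [integral_const_mul, integral_comp_eval (μ := fun _ : ι => gaussianReal 0 1) (i := i)
      (f := fun x : ℝ => (x ^ 2 - 1) ^ k) (by fun_prop)]
  have hintpi : ∀ (i : ι) (k : ℕ), Integrable (fun y : ι → ℝ => (lam i * (y i ^ 2 - 1)) ^ k)
      (Measure.pi fun _ : ι => gaussianReal 0 1) := by
    intro i k
    simp_rw [mul_pow]
    exact (integrable_comp_eval (μ := fun _ : ι => gaussianReal 0 1) (i := i) (hp k)).const_mul _
  obtain ⟨r0, -, r2, r3, r4⟩ := moments_sum_of_iIndepFun hind (fun i => by fun_prop) hintpi lam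
    (fun i => by have := hpi i 1; rw [c1] at this; simpa using this) (fun i => by rw [hpi, c2, mul_comm])
    (fun i => by rw [hpi, c3, mul_comm]) (fun i => by rw [hpi, c4, mul_comm]) Finset.univ
  have hI : ∀ n, ∫ x : EuclideanSpace ℝ ι, (x ⬝ᵥ N *ᵥ x) ^ n
      ∂(stdGaussian (EuclideanSpace ℝ ι)) =
      ∫ y : ι → ℝ, (∑ i, lam i * (y i ^ 2 - 1)) ^ n
        ∂(Measure.pi fun _ : ι => gaussianReal 0 1) := by
    intro n
    rw [hmap, integral_map hmeas.aemeasurable (hcp n).aestronglyMeasurable]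
    simp_rw [hq]
  refine ⟨fun n => ?_, by rw [hI, r2], by rw [hI, r3], by rw [hI]; exact r4⟩
  rw [hmap, integrable_map_measure (hcp n).aestronglyMeasurable hmeas.aemeasurable]
  refine (r0 n).congr (.of_forall fun y => ?_)
  simp only [Function.comp, hq]

open Matrix in
open scoped MatrixOrder in
/-- The moments of a centered quadratic form in a Gaussian vector. -/
theorem moments_dotProduct_mulVec_multivariateGaussian {ι : Type*} [Fintype ι] [DecidableEq ι]
    {C M : Matrix ι ι ℝ} (hC : C.PosSemidef) (hM : M.IsHermitian) (htr : (M * C).trace = 0) :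
    (∀ n, Integrable (fun x : EuclideanSpace ℝ ι => (x ⬝ᵥ M *ᵥ x) ^ n)
      (multivariateGaussian 0 C)) ∧
    ∫ x : EuclideanSpace ℝ ι, (x ⬝ᵥ M *ᵥ x) ^ 2 ∂(multivariateGaussian 0 C) =
      2 * (M * C * (M * C)).trace ∧
    ∫ x : EuclideanSpace ℝ ι, (x ⬝ᵥ M *ᵥ x) ^ 3 ∂(multivariateGaussian 0 C) =
      8 * (M * C * (M * C) * (M * C)).trace ∧
    ∫ x : EuclideanSpace ℝ ι, (x ⬝ᵥ M *ᵥ x) ^ 4 ∂(multivariateGaussian 0 C) ≤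
      60 * (M * C * (M * C)).trace ^ 2 := by
  -- The Gaussian vector is `S = √C` applied to a standard one, so the form becomes that of `S M S`;
  -- cyclicity of the trace converts traces of its powers into those of `M C`.
  set S := CFC.sqrt C with hS
  have hSS : S * S = C := CFC.sqrt_mul_sqrt_self _ hC.nonneg
  have hSt : Sᵀ = S := by
    have := (CFC.sqrt_nonneg C).isSelfAdjoint.star_eq
    rwa [star_eq_conjTranspose, conjTranspose_eq_transpose_of_trivial] at this
  have hN : (S * M * S).IsHermitian := by
    have hMt : Mᵀ = M := by
      have := hM.eq
      rwa [conjTranspose_eq_transpose_of_trivial] at this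
    rw [IsHermitian, conjTranspose_eq_transpose_of_trivial, transpose_mul, transpose_mul, hSt, hMt,
      mul_assoc]
  have t1 : (S * M * S).trace = 0 := by rw [mul_assoc, trace_mul_comm, mul_assoc, hSS, htr]
  have t2 : (S * M * S * (S * M * S)).trace = (M * C * (M * C)).trace := by
    rw [show S * M * S * (S * M * S) = S * (M * (S * S) * M * S) by simp only [mul_assoc],
      trace_mul_comm, hSS, show M * C * M * S * S = M * C * (M * (S * S)) by simp only [mul_assoc],
      hSS]
  have t3 : (S * M * S * (S * M * S) * (S * M * S)).trace =
      (M * C * (M * C) * (M * C)).trace := by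
    rw [show S * M * S * (S * M * S) * (S * M * S) = S * (M * (S * S) * (M * (S * S)) * M * S) by
      simp only [mul_assoc], trace_mul_comm, hSS,
      show M * C * (M * C) * M * S * S = M * C * (M * C) * (M * (S * S)) by simp only [mul_assoc],
      hSS]
  obtain ⟨r0, r2, r3, r4⟩ := moments_dotProduct_mulVec_stdGaussian _ hN t1
  rw [t2] at r2 r4
  rw [t3] at r3
  have hmeas : Measurable (fun x : EuclideanSpace ℝ ι =>
      (0 : EuclideanSpace ℝ ι) + toEuclideanCLM (𝕜 := ℝ) S x) := by fun_prop
  have hq : ∀ x : EuclideanSpace ℝ ι,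
      (⇑((0 : EuclideanSpace ℝ ι) + toEuclideanCLM (𝕜 := ℝ) S x) : ι → ℝ) ⬝ᵥ
        M *ᵥ (⇑((0 : EuclideanSpace ℝ ι) + toEuclideanCLM (𝕜 := ℝ) S x) : ι → ℝ) =
      x ⬝ᵥ (S * M * S) *ᵥ x := by
    intro x
    rw [zero_add, ofLp_toEuclideanCLM, ← mulVec_mulVec, ← mulVec_mulVec, dotProduct_mulVec x S,
      ← mulVec_transpose, hSt]
  have hcp : ∀ n : ℕ, Continuous (fun x : EuclideanSpace ℝ ι => (x ⬝ᵥ M *ᵥ x) ^ n) := by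
    intro n
    unfold dotProduct mulVec dotProduct
    fun_prop
  have hI : ∀ n, ∫ x : EuclideanSpace ℝ ι, (x ⬝ᵥ M *ᵥ x) ^ n ∂(multivariateGaussian 0 C) =
      ∫ x : EuclideanSpace ℝ ι, (x ⬝ᵥ (S * M * S) *ᵥ x) ^ n
        ∂(stdGaussian (EuclideanSpace ℝ ι)) := by
    intro n
    rw [multivariateGaussian, integral_map hmeas.aemeasurable (hcp n).aestronglyMeasurable]
    simp_rw [hq]
  refine ⟨fun n => ?_, by rw [hI, r2], by rw [hI, r3], by rw [hI]; exact r4⟩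
  rw [multivariateGaussian, integrable_map_measure (hcp n).aestronglyMeasurable hmeas.aemeasurable]
  refine (r0 n).congr (.of_forall fun y => ?_)
  simp only [Function.comp, hq]

/-- The Gram matrix of the indicators of a finite family of sets. -/
noncomputable def gramMatrix {ι : Type*} (U : ι → FiniteBorel) : Matrix ι ι ℝ :=
  Matrix.of fun i j => volume.real ((U i).1 ∩ (U j).1)

/-- The quadratic form with matrix `M` in the values of a random measure on the sets `U i`. -/
noncomputable def quadForm {Ω ι : Type*} [Fintype ι] (B : FiniteBorel → Ω → ℝ)
    (U : ι → FiniteBorel) (M : Matrix ι ι ℝ) (ω : Ω) : ℝ :=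
  ∑ i, ∑ j, M i j * (B (U i) ω * B (U j) ω)

/-! ### Finite-dimensional laws of a Brownian random measure. -/

namespace IsBrownianRandomMeasure

variable {Ω : Type*} [MeasurableSpace Ω] {P : Measure Ω}
  {B : FiniteBorel → Ω → ℝ}

theorem memLp_two (hB : IsBrownianRandomMeasure P B) (S : FiniteBorel) : MemLp (B S) 2 P :=
  (hB.gaussian.hasGaussianLaw_eval S).memLp_two

theorem cov_eq [IsProbabilityMeasure P] (hB : IsBrownianRandomMeasure P B) (S T : FiniteBorel) :
    cov[B S, B T; P] = volume.real (S.1 ∩ T.1) := by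
  rw [covariance_eq_sub (hB.memLp_two S) (hB.memLp_two T), hB.mean_zero S, zero_mul, sub_zero,
    ← hB.covariance]
  rfl

variable {ι : Type*} [Fintype ι]

/-- The quadratic form of the Gram matrix at `x` is the expectation of `(∑ xᵢ B(Uᵢ))²`. -/
theorem gramMatrix_posSemidef (hB : IsBrownianRandomMeasure P B) (U : ι → FiniteBorel) :
    (gramMatrix U).PosSemidef := by
  refine Matrix.PosSemidef.of_dotProduct_mulVec_nonneg ?_ fun x => ?_
  · ext i j
    simp [gramMatrix, Set.inter_comm]
  · have hint : ∀ i j, Integrable (fun ω => x i * x j * (B (U i) ω * B (U j) ω)) P := fun i j =>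
      ((hB.memLp_two (U i)).integrable_mul (hB.memLp_two (U j))).const_mul _
    have : star x ⬝ᵥ (gramMatrix U).mulVec x = ∫ ω, (∑ i, x i * B (U i) ω) ^ 2 ∂P := by
      have h1 : (fun ω => (∑ i, x i * B (U i) ω) ^ 2) =
          fun ω => ∑ i, ∑ j, x i * x j * (B (U i) ω * B (U j) ω) := by
        ext ω
        rw [sq, Finset.sum_mul_sum]
        exact Finset.sum_congr rfl fun _ _ => Finset.sum_congr rfl fun _ _ => by ring
      rw [h1, integral_finsetSum _ fun i _ => integrable_finsetSum _ fun j _ => hint i j]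
      simp_rw [integral_finsetSum _ fun j _ => hint _ j, integral_const_mul, hB.covariance]
      simp only [dotProduct, Matrix.mulVec, gramMatrix, Finset.mul_sum, Matrix.of_apply,
        star_trivial]
      exact Finset.sum_congr rfl fun _ _ => Finset.sum_congr rfl fun _ _ => by ring
    rw [this]
    exact integral_nonneg fun _ => sq_nonneg _

theorem hasGaussianLaw_toLp (hB : IsBrownianRandomMeasure P B) (U : ι → FiniteBorel) :
    HasGaussianLaw (fun ω => (WithLp.toLp 2 (fun i => B (U i) ω) : EuclideanSpace ℝ ι)) P := by
  let L : (↥(Finset.univ : Finset ι) → ℝ) →L[ℝ] (ι → ℝ) :=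
    ContinuousLinearMap.pi fun i => ContinuousLinearMap.proj ⟨i, Finset.mem_univ i⟩
  have h := ((hB.gaussian.comp_right U).hasGaussianLaw Finset.univ).map_fun L
  exact h.map_equiv_fun (PiLp.continuousLinearEquiv 2 ℝ (fun _ : ι => ℝ)).symm

/-- A Gaussian law is determined by its mean and covariance, and the latter can be compared on the
standard basis. -/
theorem map_toLp_eq_multivariateGaussian [IsProbabilityMeasure P] [DecidableEq ι]
    (hB : IsBrownianRandomMeasure P B)
    (U : ι → FiniteBorel) :
    P.map (fun ω => (WithLp.toLp 2 (fun i => B (U i) ω) : EuclideanSpace ℝ ι)) =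
      multivariateGaussian 0 (gramMatrix U) := by
  have hG := hB.hasGaussianLaw_toLp U
  have := hG.isGaussian_map
  have hS := hB.gramMatrix_posSemidef U
  apply IsGaussian.ext
  · simp only [id_eq, integral_id_multivariateGaussian]
    rw [integral_map hG.aemeasurable (by fun_prop)]
    ext i
    rw [eval_integral_piLp]
    · simpa using hB.mean_zero (U i)
    · exact fun i => (hB.memLp_two (U i)).integrable (by norm_num)
  · rw [← ContinuousLinearMap.toBilinForm_inj]
    refine LinearMap.BilinForm.ext_basis (EuclideanSpace.basisFun ι ℝ).toBasis fun i j ↦ ?_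
    rw [ContinuousLinearMap.toBilinForm_apply, ContinuousLinearMap.toBilinForm_apply,
      covarianceBilin_apply_eq_cov, covariance_map]
    · have (i : ι) : (fun u ↦ inner ℝ ((EuclideanSpace.basisFun ι ℝ).toBasis i) u) ∘
          (fun ω => (WithLp.toLp 2 (fun i => B (U i) ω) : EuclideanSpace ℝ ι)) = B (U i) := by
        ext; simp [PiLp.inner_apply]
      simp_rw [this, hB.cov_eq, covarianceBilin_multivariateGaussian hS]
      simp [gramMatrix]
    any_goals exact Measurable.aestronglyMeasurable (by fun_prop)
    · exact hG.aemeasurable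
    · exact IsGaussian.memLp_two_id

open Matrix in
/-- The moments of a centered quadratic form in a Brownian random measure. -/
theorem moments_quadForm [IsProbabilityMeasure P] (hB : IsBrownianRandomMeasure P B) (U : ι → FiniteBorel)
    {M : Matrix ι ι ℝ} (hM : M.IsHermitian) (htr : (M * gramMatrix U).trace = 0) :
    (∀ n, Integrable (fun ω => quadForm B U M ω ^ n) P) ∧
    ∫ ω, quadForm B U M ω ^ 2 ∂P = 2 * (M * gramMatrix U * (M * gramMatrix U)).trace ∧
    ∫ ω, quadForm B U M ω ^ 3 ∂P =
      8 * (M * gramMatrix U * (M * gramMatrix U) * (M * gramMatrix U)).trace ∧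
    ∫ ω, quadForm B U M ω ^ 4 ∂P ≤ 60 * (M * gramMatrix U * (M * gramMatrix U)).trace ^ 2 := by
  classical
  obtain ⟨r0, r2, r3, r4⟩ := moments_dotProduct_mulVec_multivariateGaussian
    (hB.gramMatrix_posSemidef U) hM htr
  have hmeas := (hB.hasGaussianLaw_toLp U).aemeasurable
  have hcp : ∀ n : ℕ, Continuous (fun x : EuclideanSpace ℝ ι => (x ⬝ᵥ M *ᵥ x) ^ n) := by
    intro n
    unfold dotProduct mulVec dotProduct
    fun_prop
  have hq : ∀ ω, quadForm B U M ω = (fun i => B (U i) ω) ⬝ᵥ M *ᵥ (fun i => B (U i) ω) := by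
    intro ω
    simp only [quadForm, dotProduct, mulVec, Finset.mul_sum]
    exact Finset.sum_congr rfl fun _ _ => Finset.sum_congr rfl fun _ _ => by ring
  have hI : ∀ n, ∫ ω, quadForm B U M ω ^ n ∂P =
      ∫ x : EuclideanSpace ℝ ι, (x ⬝ᵥ M *ᵥ x) ^ n ∂(multivariateGaussian 0 (gramMatrix U)) := by
    intro n
    rw [← hB.map_toLp_eq_multivariateGaussian U, integral_map hmeas
      (hcp n).aestronglyMeasurable]
    simp_rw [hq]
  refine ⟨fun n => ?_, by rw [hI, r2], by rw [hI, r3], by rw [hI]; exact r4⟩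
  have := r0 n
  rw [← hB.map_toLp_eq_multivariateGaussian U, integrable_map_measure
      (hcp n).aestronglyMeasurable hmeas] at this
  refine this.congr (.of_forall fun y => ?_)
  simp only [Function.comp, hq]

end IsBrownianRandomMeasure

/-! ### Elementary integrands -/

/-- The function `∑ i j, M i j * 1_{U i × U j}` on the plane. -/
noncomputable def tensorSum {ι : Type*} [Fintype ι] (U : ι → FiniteBorel) (M : Matrix ι ι ℝ)
    (x : ℝ × ℝ) : ℝ :=
  ∑ i, ∑ j, M i j *
    ((U i).1.indicator (fun _ => (1 : ℝ)) x.1 * (U j).1.indicator (fun _ => (1 : ℝ)) x.2)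

/-- The symmetrization of a function of two variables. -/
noncomputable def symmetrize (g : ℝ × ℝ → ℝ) (x : ℝ × ℝ) : ℝ := (g x + g x.swap) / 2

/-- The trace of the third power of the integral operator with kernel `g`. -/
noncomputable def cyclicIntegral (g : ℝ × ℝ → ℝ) : ℝ :=
  ∫ p : ℝ × ℝ × ℝ, g (p.1, p.2.1) * (g (p.2.1, p.2.2) * g (p.2.2, p.1))

section

variable {ι : Type*} [Fintype ι] (U : ι → FiniteBorel) (M : Matrix ι ι ℝ)

theorem integrable_indicator_mul_indicator (S T : FiniteBorel) :
    Integrable fun x : ℝ => S.1.indicator (fun _ => (1 : ℝ)) x * T.1.indicator (fun _ => 1) x := by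
  have : (fun x : ℝ => S.1.indicator (fun _ => (1 : ℝ)) x * T.1.indicator (fun _ => 1) x) =
      (S.1 ∩ T.1).indicator fun _ => 1 := by
    ext x
    by_cases hS : x ∈ S.1 <;> by_cases hT : x ∈ T.1 <;> simp [hS, hT]
  rw [this, integrable_indicator_iff (S.2.1.inter T.2.1)]
  exact integrableOn_const (ne_top_of_le_ne_top S.2.2 (measure_mono Set.inter_subset_left))

theorem integral_indicator_mul_indicator (S T : FiniteBorel) :
    ∫ x : ℝ, S.1.indicator (fun _ => (1 : ℝ)) x * T.1.indicator (fun _ => 1) x =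
      volume.real (S.1 ∩ T.1) := by
  have : (fun x : ℝ => S.1.indicator (fun _ => (1 : ℝ)) x * T.1.indicator (fun _ => 1) x) =
      (S.1 ∩ T.1).indicator fun _ => 1 := by
    ext x
    by_cases hS : x ∈ S.1 <;> by_cases hT : x ∈ T.1 <;> simp [hS, hT]
  rw [this, integral_indicator (S.2.1.inter T.2.1)]
  simp

theorem memLp_tensorSum : MemLp (tensorSum U M) 2 := by
  unfold tensorSum
  refine memLp_finsetSum _ fun i _ => memLp_finsetSum _ fun j _ => MemLp.const_mul ?_ _
  refine (memLp_two_iff_integrable_sq ?_).2 ?_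
  · exact (((measurable_const.indicator (U i).2.1).comp measurable_fst).mul
      ((measurable_const.indicator (U j).2.1).comp measurable_snd)).aestronglyMeasurable
  · simp_rw [mul_pow, sq]
    exact (integrable_indicator_mul_indicator (U i) (U i)).mul_prod
      (integrable_indicator_mul_indicator (U j) (U j))

/-- The product of the `i`-th row of a tensor sum with the `k`-th indicator. -/
noncomputable def tensorRow (i k : ι) (y : ℝ) : ℝ :=
  (∑ j, M i j * (U j).1.indicator (fun _ => (1 : ℝ)) y) * (U k).1.indicator (fun _ => (1 : ℝ)) y

theorem tensorRow_eq (i k : ι) : tensorRow U M i k = fun y => ∑ j, M i j *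
    ((U j).1.indicator (fun _ => (1 : ℝ)) y * (U k).1.indicator (fun _ => (1 : ℝ)) y) := by
  ext y
  simp [tensorRow, Finset.sum_mul, mul_assoc]

theorem integrable_tensorRow (i k : ι) : Integrable (tensorRow U M i k) := by
  rw [tensorRow_eq]
  exact integrable_finsetSum _ fun j _ => (integrable_indicator_mul_indicator _ _).const_mul _

theorem integral_tensorRow (i k : ι) : ∫ y, tensorRow U M i k y = (M * gramMatrix U) i k := by
  rw [tensorRow_eq,
    integral_finsetSum _ fun j _ => (integrable_indicator_mul_indicator _ _).const_mul _]
  simp_rw [integral_const_mul, integral_indicator_mul_indicator]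
  simp [Matrix.mul_apply, gramMatrix]

theorem tensorSum_eq (x y : ℝ) : tensorSum U M (x, y) =
    ∑ i, (U i).1.indicator (fun _ => (1 : ℝ)) x *
      ∑ j, M i j * (U j).1.indicator (fun _ => (1 : ℝ)) y := by
  simp only [tensorSum, Finset.mul_sum]
  exact Finset.sum_congr rfl fun _ _ => Finset.sum_congr rfl fun _ _ => by ring

/-- Grouping the factors by variable leaves one `tensorRow` per variable, and each integrates to an
entry of `M * gramMatrix U`. The swapped argument closes the chain of indices into a trace; for a
symmetric kernel the integrand is the square. -/
theorem integral_tensorSum_mul_swap :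
    ∫ x : ℝ × ℝ, tensorSum U M x * tensorSum U M x.swap =
      (M * gramMatrix U * (M * gramMatrix U)).trace := by
  have h : ∀ x : ℝ × ℝ, tensorSum U M x * tensorSum U M x.swap =
      ∑ i, ∑ k, tensorRow U M k i x.1 * tensorRow U M i k x.2 := by
    rintro ⟨x, y⟩
    rw [Prod.swap_prod_mk, tensorSum_eq, tensorSum_eq, Finset.sum_mul_sum]
    exact Finset.sum_congr rfl fun _ _ => Finset.sum_congr rfl fun _ _ => by
      simp only [tensorRow]; ring
  have hint : ∀ i k, Integrable fun x : ℝ × ℝ =>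
      tensorRow U M k i x.1 * tensorRow U M i k x.2 := fun i k =>
    (integrable_tensorRow U M k i).mul_prod (integrable_tensorRow U M i k)
  simp_rw [h]
  rw [integral_finsetSum _ fun i _ => integrable_finsetSum _ fun k _ => hint i k]
  simp_rw [integral_finsetSum _ fun k _ => hint _ k]
  simp only [Matrix.trace, Matrix.diag_apply]
  refine Finset.sum_congr rfl fun i _ => ?_
  rw [Matrix.mul_apply]
  refine Finset.sum_congr rfl fun k _ => ?_
  rw [← integral_tensorRow, ← integral_tensorRow, mul_comm]
  exact integral_prod_mul _ _

/-- The same grouping by variable, now with three links in the chain. -/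
theorem cyclicIntegral_tensorSum : cyclicIntegral (tensorSum U M) =
    (M * gramMatrix U * (M * gramMatrix U) * (M * gramMatrix U)).trace := by
  have h : ∀ p : ℝ × ℝ × ℝ, tensorSum U M (p.1, p.2.1) *
      (tensorSum U M (p.2.1, p.2.2) * tensorSum U M (p.2.2, p.1)) =
      ∑ i, ∑ k, ∑ l, tensorRow U M l i p.1 *
        (tensorRow U M i k p.2.1 * tensorRow U M k l p.2.2) := by
    rintro ⟨x, y, z⟩
    simp only [tensorSum_eq]
    rw [Finset.sum_mul_sum, Finset.sum_mul_sum]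
    refine Finset.sum_congr rfl fun _ _ => Finset.sum_congr rfl fun _ _ => ?_
    rw [Finset.mul_sum]
    exact Finset.sum_congr rfl fun _ _ => by
      simp only [tensorRow]; ring
  have hint : ∀ i k l, Integrable fun p : ℝ × ℝ × ℝ =>
      tensorRow U M l i p.1 * (tensorRow U M i k p.2.1 * tensorRow U M k l p.2.2) := fun i k l =>
    (integrable_tensorRow U M l i).mul_prod
      ((integrable_tensorRow U M i k).mul_prod (integrable_tensorRow U M k l))
  rw [cyclicIntegral]
  simp_rw [h]
  rw [integral_finsetSum _ fun i _ => integrable_finsetSum _ fun k _ =>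
    integrable_finsetSum _ fun l _ => hint i k l]
  simp_rw [integral_finsetSum _ fun k _ => integrable_finsetSum _ fun l _ => hint _ k l,
    integral_finsetSum _ fun l _ => hint _ _ l]
  simp only [Matrix.trace, Matrix.diag_apply]
  refine Finset.sum_congr rfl fun i _ => ?_
  rw [Matrix.mul_assoc, Matrix.mul_apply]
  refine Finset.sum_congr rfl fun k _ => ?_
  rw [Matrix.mul_apply (M := M * gramMatrix U) (N := M * gramMatrix U), Finset.mul_sum]
  refine Finset.sum_congr rfl fun l _ => ?_
  rw [← integral_tensorRow, ← integral_tensorRow, ← integral_tensorRow]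
  have h1 := integral_prod_mul (μ := (volume : Measure ℝ)) (ν := (volume : Measure (ℝ × ℝ)))
    (tensorRow U M l i) (fun q : ℝ × ℝ => tensorRow U M i k q.1 * tensorRow U M k l q.2)
  have h2 := integral_prod_mul (μ := (volume : Measure ℝ)) (ν := (volume : Measure ℝ))
    (tensorRow U M i k) (tensorRow U M k l)
  have h3 : ∫ p : ℝ × ℝ × ℝ,
      tensorRow U M l i p.1 * (tensorRow U M i k p.2.1 * tensorRow U M k l p.2.2) =
      (∫ x, tensorRow U M l i x) *
        ∫ q : ℝ × ℝ, tensorRow U M i k q.1 * tensorRow U M k l q.2 := h1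
  have h4 : ∫ q : ℝ × ℝ, tensorRow U M i k q.1 * tensorRow U M k l q.2 =
      (∫ x, tensorRow U M i k x) * ∫ x, tensorRow U M k l x := h2
  rw [h3, h4]
  ring

theorem tensorSum_symm :
    tensorSum U ((1 / 2 : ℝ) • (M + M.transpose)) = symmetrize (tensorSum U M) := by
  ext x
  have : tensorSum U M x.swap = ∑ i, ∑ j, M j i * ((U i).1.indicator (fun _ => (1 : ℝ)) x.1 *
      (U j).1.indicator (fun _ => (1 : ℝ)) x.2) := by
    rw [tensorSum, Finset.sum_comm]
    exact Finset.sum_congr rfl fun _ _ => Finset.sum_congr rfl fun _ _ => by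
      simp only [Prod.fst_swap, Prod.snd_swap]; ring
  rw [symmetrize, this, tensorSum, tensorSum, ← Finset.sum_add_distrib, Finset.sum_div]
  refine Finset.sum_congr rfl fun i _ => ?_
  rw [← Finset.sum_add_distrib, Finset.sum_div]
  refine Finset.sum_congr rfl fun j _ => ?_
  simp only [Matrix.smul_apply, Matrix.add_apply, Matrix.transpose_apply, smul_eq_mul]
  ring

/-- Products of values of `B` commute, so only the symmetric part of `M` matters. This removes the
symmetry hypothesis of `moments_quadForm` at the price of symmetrizing the kernel. -/
theorem quadForm_symm {Ω : Type*} (B : FiniteBorel → Ω → ℝ) :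
    quadForm B U ((1 / 2 : ℝ) • (M + M.transpose)) = quadForm B U M := by
  ext ω
  have : quadForm B U M ω = ∑ i, ∑ j, M j i * (B (U i) ω * B (U j) ω) := by
    rw [quadForm, Finset.sum_comm]
    exact Finset.sum_congr rfl fun _ _ => Finset.sum_congr rfl fun _ _ => by ring
  have h2 : quadForm B U M ω =
      (quadForm B U M ω + ∑ i, ∑ j, M j i * (B (U i) ω * B (U j) ω)) / 2 := by
    rw [← this]; ring
  rw [h2, quadForm, quadForm, ← Finset.sum_add_distrib, Finset.sum_div]
  refine Finset.sum_congr rfl fun i _ => ?_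
  rw [← Finset.sum_add_distrib, Finset.sum_div]
  refine Finset.sum_congr rfl fun j _ => ?_
  simp only [Matrix.smul_apply, Matrix.add_apply, Matrix.transpose_apply, smul_eq_mul]
  ring

/-- The moments of a quadratic form in a Brownian random measure in terms of its kernel. -/
theorem IsBrownianRandomMeasure.moments_quadForm_tensorSum {Ω : Type*} [MeasurableSpace Ω]
    {P : Measure Ω} [IsProbabilityMeasure P] {B : FiniteBorel → Ω → ℝ}
    (hB : IsBrownianRandomMeasure P B) (htr : (M * gramMatrix U).trace = 0) :
    (∀ n, Integrable (fun ω => quadForm B U M ω ^ n) P) ∧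
    ∫ ω, quadForm B U M ω ^ 2 ∂P = 2 * ∫ x, symmetrize (tensorSum U M) x ^ 2 ∧
    ∫ ω, quadForm B U M ω ^ 3 ∂P = 8 * cyclicIntegral (symmetrize (tensorSum U M)) ∧
    ∫ ω, quadForm B U M ω ^ 4 ∂P ≤ 60 * (∫ x, symmetrize (tensorSum U M) x ^ 2) ^ 2 := by
  have hM : ((1 / 2 : ℝ) • (M + M.transpose)).IsHermitian := by
    ext i j
    simp
    ring
  have hCt : (gramMatrix U).transpose = gramMatrix U := by
    ext i j
    simp [gramMatrix, Set.inter_comm]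
  have htr' : (((1 / 2 : ℝ) • (M + M.transpose)) * gramMatrix U).trace = 0 := by
    rw [Matrix.smul_mul, Matrix.trace_smul, Matrix.add_mul, Matrix.trace_add, htr,
      Matrix.trace_mul_comm, ← Matrix.trace_transpose, Matrix.transpose_mul,
      Matrix.transpose_transpose, hCt, htr]
    simp
  have h := hB.moments_quadForm U hM htr'
  rw [← integral_tensorSum_mul_swap, ← cyclicIntegral_tensorSum, quadForm_symm,
    tensorSum_symm] at h
  have hsw : ∀ x : ℝ × ℝ, symmetrize (tensorSum U M) x * symmetrize (tensorSum U M) x.swap =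
      symmetrize (tensorSum U M) x ^ 2 := fun x => by
    simp only [symmetrize, Prod.swap_swap]; ring
  simp_rw [hsw] at h
  exact h

end

/-! ### Differences of elementary kernels. -/

section

variable {ι κ : Type*} [Fintype ι] [Fintype κ]

/-- Two elementary kernels over unrelated families are combined over the disjoint union of the index
types. No common refinement is needed, since the moment formulas ask only for a vanishing trace, not
for disjoint sets. -/
theorem tensorSum_sub (U : ι → FiniteBorel) (M : Matrix ι ι ℝ) (V : κ → FiniteBorel)
    (N : Matrix κ κ ℝ) :
    tensorSum (Sum.elim U V) (Matrix.fromBlocks M 0 0 (-N)) =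
      fun x => tensorSum U M x - tensorSum V N x := by
  ext x
  simp [tensorSum, Fintype.sum_sum_type, sub_eq_add_neg]

theorem quadForm_sub {Ω : Type*} (B : FiniteBorel → Ω → ℝ) (U : ι → FiniteBorel)
    (M : Matrix ι ι ℝ) (V : κ → FiniteBorel) (N : Matrix κ κ ℝ) :
    quadForm B (Sum.elim U V) (Matrix.fromBlocks M 0 0 (-N)) =
      fun ω => quadForm B U M ω - quadForm B V N ω := by
  ext x
  simp [quadForm, Fintype.sum_sum_type, sub_eq_add_neg]

theorem trace_mul_gramMatrix_sub {U : ι → FiniteBorel} {M : Matrix ι ι ℝ} {V : κ → FiniteBorel}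
    {N : Matrix κ κ ℝ} (hM : (M * gramMatrix U).trace = 0) (hN : (N * gramMatrix V).trace = 0) :
    (Matrix.fromBlocks M 0 0 (-N) * gramMatrix (Sum.elim U V)).trace = 0 := by
  simp only [Matrix.trace, Matrix.diag_apply, Matrix.mul_apply, gramMatrix, Matrix.of_apply]
    at hM hN ⊢
  simp [Fintype.sum_sum_type, hM, hN]

end

/-! ### Moments of the elementary double integrals. -/

namespace OffDiagSimple

/-- Every term vanishes: off the diagonal the sets are disjoint, on the diagonal the coefficient is
zero. This is the centering that the exclusion of diagonals provides. -/
theorem trace_mul_gramMatrix (φ : OffDiagSimple) :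
    (Matrix.of φ.coeff * gramMatrix φ.set).trace = 0 := by
  simp only [Matrix.trace, Matrix.diag_apply, Matrix.mul_apply, gramMatrix, Matrix.of_apply]
  refine Finset.sum_eq_zero fun i _ => Finset.sum_eq_zero fun j _ => ?_
  by_cases h : i = j
  · subst h; simp [φ.coeff_diag]
  · have := (φ.disjoint j i (Ne.symm h)).inter_eq
    simp [this]

variable {Ω : Type*} [MeasurableSpace Ω] {P : Measure Ω} [IsProbabilityMeasure P]
  {B : FiniteBorel → Ω → ℝ}

theorem memLp_toFun (φ : OffDiagSimple) : MemLp φ.toFun 2 := memLp_tensorSum φ.set (Matrix.of φ.coeff)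

theorem moments_integral (φ : OffDiagSimple) (hB : IsBrownianRandomMeasure P B) :
    (∀ n, Integrable (fun ω => φ.integral B ω ^ n) P) ∧
    ∫ ω, φ.integral B ω ^ 2 ∂P = 2 * ∫ x, symmetrize φ.toFun x ^ 2 ∧
    ∫ ω, φ.integral B ω ^ 3 ∂P = 8 * cyclicIntegral (symmetrize φ.toFun) ∧
    ∫ ω, φ.integral B ω ^ 4 ∂P ≤ 60 * (∫ x, symmetrize φ.toFun x ^ 2) ^ 2 :=
  hB.moments_quadForm_tensorSum φ.set (Matrix.of φ.coeff) φ.trace_mul_gramMatrix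

/-- The Itô isometry for differences, which transfers the Cauchy property from kernels to integrals.
-/
theorem integral_sub_sq (φ ψ : OffDiagSimple) (hB : IsBrownianRandomMeasure P B) :
    Integrable (fun ω => (φ.integral B ω - ψ.integral B ω) ^ 2) P ∧
    ∫ ω, (φ.integral B ω - ψ.integral B ω) ^ 2 ∂P =
      2 * ∫ x, symmetrize (fun x => φ.toFun x - ψ.toFun x) x ^ 2 := by
  have h := hB.moments_quadForm_tensorSum (Sum.elim φ.set ψ.set)
    (Matrix.fromBlocks (Matrix.of φ.coeff) 0 0 (-Matrix.of ψ.coeff)) (trace_mul_gramMatrix_sub φ.trace_mul_gramMatrix ψ.trace_mul_gramMatrix)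
  rw [tensorSum_sub, quadForm_sub] at h
  exact ⟨h.1 2, h.2.1⟩

end OffDiagSimple

/-! ### Convergence in `L²` -/

section

variable {α : Type*} [MeasurableSpace α] {μ : Measure α}

theorem MeasureTheory.MemLp.eLpNorm_two_eq_sqrt {a : α → ℝ} (ha : MemLp a 2 μ) :
    eLpNorm a 2 μ = ENNReal.ofReal (√(∫ x, a x ^ 2 ∂μ)) := by
  rw [ha.eLpNorm_eq_integral_rpow_norm (by norm_num) (by norm_num), Real.sqrt_eq_rpow]
  norm_num

theorem MeasureTheory.MemLp.sq_toReal_eLpNorm_two {a : α → ℝ} (ha : MemLp a 2 μ) :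
    (eLpNorm a 2 μ).toReal ^ 2 = ∫ x, a x ^ 2 ∂μ := by
  rw [ha.eLpNorm_two_eq_sqrt, ENNReal.toReal_ofReal (Real.sqrt_nonneg _),
    Real.sq_sqrt (integral_nonneg fun _ => sq_nonneg _)]

theorem tendsto_toReal_eLpNorm_of_tendsto_sub {a : ℕ → α → ℝ} {b : α → ℝ}
    (ha : ∀ k, MemLp (a k) 2 μ) (hb : MemLp b 2 μ)
    (h : Tendsto (fun k => eLpNorm (fun x => a k x - b x) 2 μ) atTop (𝓝 0)) :
    Tendsto (fun k => (eLpNorm (a k) 2 μ).toReal) atTop (𝓝 (eLpNorm b 2 μ).toReal) := by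
  have := (Lp.tendsto_Lp_iff_tendsto_eLpNorm'' a ha b hb).2 h
  simpa only [Lp.norm_toLp] using this.norm

theorem tendsto_integral_sq_of_tendsto_sub {a : ℕ → α → ℝ} {b : α → ℝ}
    (ha : ∀ k, MemLp (a k) 2 μ) (hb : MemLp b 2 μ)
    (h : Tendsto (fun k => eLpNorm (fun x => a k x - b x) 2 μ) atTop (𝓝 0)) :
    Tendsto (fun k => ∫ x, a k x ^ 2 ∂μ) atTop (𝓝 (∫ x, b x ^ 2 ∂μ)) := by
  simp_rw [← hb.sq_toReal_eLpNorm_two, ← (ha _).sq_toReal_eLpNorm_two]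
  exact (tendsto_toReal_eLpNorm_of_tendsto_sub ha hb h).pow 2

theorem integral_abs_mul_le {a b : α → ℝ} (ha : MemLp a 2 μ) (hb : MemLp b 2 μ) :
    ∫ x, |a x| * |b x| ∂μ ≤ (eLpNorm a 2 μ).toReal * (eLpNorm b 2 μ).toReal := by
  have := integral_mul_norm_le_Lp_mul_Lq (μ := μ) Real.HolderConjugate.two_two
    (by simpa using ha) (by simpa using hb)
  rw [ha.eLpNorm_two_eq_sqrt, hb.eLpNorm_two_eq_sqrt, ENNReal.toReal_ofReal (Real.sqrt_nonneg _),
    ENNReal.toReal_ofReal (Real.sqrt_nonneg _), Real.sqrt_eq_rpow, Real.sqrt_eq_rpow]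
  simpa using this

/-- Convergence in `L²` together with a bound in `L⁴` gives convergence of third moments. -/
theorem tendsto_integral_cube [IsProbabilityMeasure μ] {a : ℕ → α → ℝ} {b : α → ℝ} {C : ℝ}
    (ha : ∀ k, MemLp (a k) 2 μ) (hb : MemLp b 2 μ) (h4 : ∀ k, Integrable (fun x => a k x ^ 4) μ)
    (hC : ∀ k, ∫ x, a k x ^ 4 ∂μ ≤ C)
    (h : Tendsto (fun k => eLpNorm (fun x => a k x - b x) 2 μ) atTop (𝓝 0)) :
    Integrable (fun x => b x ^ 3) μ ∧
      Tendsto (fun k => ∫ x, a k x ^ 3 ∂μ) atTop (𝓝 (∫ x, b x ^ 3 ∂μ)) := by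
  have hasq : ∀ k, MemLp (fun x => a k x ^ 2) 2 μ := fun k =>
    (memLp_two_iff_integrable_sq ((ha k).1.pow 2)).2 ((h4 k).congr (.of_forall fun x => by
      simp only [Pi.pow_apply]; ring))
  have hbound : ∀ k, (eLpNorm (fun x => a k x ^ 2) 2 μ).toReal ≤ √C := by
    intro k
    refine Real.le_sqrt_of_sq_le ?_
    rw [(hasq k).sq_toReal_eLpNorm_two]
    refine le_trans (le_of_eq (integral_congr_ae (.of_forall fun x => ?_))) (hC k)
    simp only []; ring
  -- Fatou along an almost everywhere convergent subsequence: the `L⁴` bound passes to the limit.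
  have hbsq : MemLp (fun x => b x ^ 2) 2 μ ∧
      (eLpNorm (fun x => b x ^ 2) 2 μ).toReal ≤ √C := by
    have hm : TendstoInMeasure μ a atTop b :=
      tendstoInMeasure_of_tendsto_eLpNorm (by norm_num) (fun k => (ha k).1) hb.1 h
    obtain ⟨ns, -, hns⟩ := hm.exists_seq_tendsto_ae
    have hle : eLpNorm (fun x => b x ^ 2) 2 μ ≤ ENNReal.ofReal (√C) := by
      refine (Lp.eLpNorm_lim_le_liminf_eLpNorm (f := fun k x => a (ns k) x ^ 2)
        (fun k => (hasq _).1) _ ?_).trans ?_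
      · filter_upwards [hns] with x hx using hx.pow 2
      · refine (liminf_le_liminf (v := fun _ => ENNReal.ofReal (√C))
          (.of_forall fun k => ?_)).trans (by simp)
        exact ENNReal.le_ofReal_iff_toReal_le (hasq _).2.ne (Real.sqrt_nonneg _) |>.2 (hbound _)
    exact ⟨⟨hb.1.pow 2, hle.trans_lt ENNReal.ofReal_lt_top⟩,
      ENNReal.toReal_le_of_le_ofReal (Real.sqrt_nonneg _) hle⟩
  have hcube : ∀ c : α → ℝ, MemLp c 2 μ → MemLp (fun x => c x ^ 2) 2 μ →
      Integrable (fun x => c x ^ 3) μ := fun c h1 h2 => by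
    refine (h1.integrable_mul h2).congr (.of_forall fun x => ?_)
    simp only [Pi.mul_apply]; ring
  refine ⟨hcube b hb hbsq.1, ?_⟩
  rw [tendsto_iff_dist_tendsto_zero]
  have hlim : Tendsto (fun k => (eLpNorm (fun x => a k x - b x) 2 μ).toReal * (3 * √C)) atTop
      (𝓝 0) := by
    have := ((ENNReal.tendsto_toReal ENNReal.zero_ne_top).comp h).mul_const (3 * √C)
    simpa using this
  refine squeeze_zero (fun _ => dist_nonneg) (fun k => ?_) hlim
  have hd : MemLp (fun x => a k x - b x) 2 μ := (ha k).sub hb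
  have i1 : Integrable (fun x => |a k x - b x| * |a k x ^ 2|) μ :=
    hd.abs.integrable_mul (hasq k).abs
  have i2 : Integrable (fun x => |a k x - b x| * |b x ^ 2|) μ :=
    hd.abs.integrable_mul hbsq.1.abs
  rw [Real.dist_eq, ← integral_sub (hcube _ (ha k) (hasq k)) (hcube b hb hbsq.1)]
  -- Factor `a³ - b³ = (a - b)(a² + ab + b²)`, bound the second factor by `3/2 (a² + b²)`, and apply
  -- Cauchy–Schwarz to each product.
  calc |∫ x, (a k x ^ 3 - b x ^ 3) ∂μ| ≤ ∫ x, |a k x ^ 3 - b x ^ 3| ∂μ :=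
        abs_integral_le_integral_abs
    _ ≤ ∫ x, (3 / 2) * (|a k x - b x| * |a k x ^ 2| + |a k x - b x| * |b x ^ 2|) ∂μ := by
        refine integral_mono_ae ((hcube _ (ha k) (hasq k)).sub (hcube b hb hbsq.1)).abs
          ((i1.add i2).const_mul (3 / 2)) (.of_forall fun x => ?_)
        have e : a k x ^ 3 - b x ^ 3 =
          (a k x - b x) * (a k x ^ 2 + a k x * b x + b x ^ 2) := by ring
        simp only [e, abs_mul, abs_pow]
        rw [← mul_add, mul_left_comm]
        refine mul_le_mul_of_nonneg_left ?_ (abs_nonneg _)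
        simp only [sq_abs]
        rw [abs_of_nonneg (by nlinarith [sq_nonneg (a k x + b x)])]
        nlinarith [sq_nonneg (a k x - b x)]
    _ = (3 / 2) * ((∫ x, |a k x - b x| * |a k x ^ 2| ∂μ) +
          ∫ x, |a k x - b x| * |b x ^ 2| ∂μ) := by
        rw [integral_const_mul, integral_add i1 i2]
    _ ≤ (3 / 2) * ((eLpNorm (fun x => a k x - b x) 2 μ).toReal * √C +
          (eLpNorm (fun x => a k x - b x) 2 μ).toReal * √C) := by
        gcongr
        · exact (integral_abs_mul_le hd (hasq k)).trans
            (mul_le_mul_of_nonneg_left (hbound k) ENNReal.toReal_nonneg)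
        · exact (integral_abs_mul_le hd hbsq.1).trans
            (mul_le_mul_of_nonneg_left hbsq.2 ENNReal.toReal_nonneg)
    _ = _ := by ring

end

/-! ### Symmetrization and cyclic integrals -/

theorem symmetrize_sub (g h : ℝ × ℝ → ℝ) :
    symmetrize (fun x => g x - h x) = fun x => symmetrize g x - symmetrize h x := by
  ext x; simp only [symmetrize]; ring

theorem symmetrize_of_comp_swap {g : ℝ × ℝ → ℝ} (hg : ∀ x, g x.swap = g x) :
    symmetrize g = g := by
  ext x; simp only [symmetrize, hg]; ring

theorem memLp_comp_swap {g : ℝ × ℝ → ℝ} (hg : MemLp g 2) :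
    MemLp (fun x : ℝ × ℝ => g x.swap) 2 :=
  hg.comp_measurePreserving Measure.measurePreserving_swap

theorem memLp_symmetrize {g : ℝ × ℝ → ℝ} (hg : MemLp g 2) : MemLp (symmetrize g) 2 := by
  refine ((hg.add (memLp_comp_swap hg)).const_mul (1 / 2)).ae_eq (.of_forall fun x => ?_)
  simp only [symmetrize, Pi.add_apply]; ring

/-- Reflection preserves the norm, so the triangle inequality applies to the average. Approximants
of a symmetric kernel need not be symmetric; this lets their symmetrizations converge too. -/
theorem eLpNorm_symmetrize_le {g : ℝ × ℝ → ℝ} (hg : MemLp g 2) :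
    eLpNorm (symmetrize g) 2 ≤ eLpNorm g 2 := by
  have h1 : symmetrize g = (1 / 2 : ℝ) • (g + fun x => g x.swap) := by
    ext x; simp only [symmetrize, Pi.add_apply, Pi.smul_apply, smul_eq_mul]; ring
  have h2 : eLpNorm (fun x : ℝ × ℝ => g x.swap) 2 = eLpNorm g 2 :=
    eLpNorm_comp_measurePreserving hg.1 Measure.measurePreserving_swap
  rw [h1, eLpNorm_const_smul]
  refine (mul_le_mul_right (eLpNorm_add_le hg.1 (memLp_comp_swap hg).1 (by norm_num)) _).trans ?_
  rw [h2, ← two_mul, ← mul_assoc]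
  refine le_of_eq ?_
  have : ‖(1 / 2 : ℝ)‖ₑ * 2 = 1 := by
    rw [Real.enorm_eq_ofReal (by norm_num), one_div, ENNReal.ofReal_inv_of_pos (by norm_num)]
    simp [ENNReal.inv_mul_cancel]
  rw [this, one_mul]

theorem lintegral_mul_le_sqrt {α : Type*} [MeasurableSpace α] (μ : Measure α)
    {f g : α → ENNReal} (hf : AEMeasurable f μ) (hg : AEMeasurable g μ) :
    ∫⁻ x, f x * g x ∂μ ≤
      (∫⁻ x, f x ^ 2 ∂μ) ^ (1 / 2 : ℝ) * (∫⁻ x, g x ^ 2 ∂μ) ^ (1 / 2 : ℝ) := by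
  simpa using ENNReal.lintegral_mul_le_Lp_mul_Lq μ Real.HolderConjugate.two_two hf hg

theorem ENNReal.rpow_half_sq (a : ENNReal) : (a ^ (1 / 2 : ℝ)) ^ 2 = a := by
  rw [← ENNReal.rpow_natCast, ← ENNReal.rpow_mul]; norm_num

/-- Cauchy–Schwarz twice: for fixed `x`, in the other two variables, separating `G₂` from `G₁(x,y)
G₃(z,x)`, whose square integrates to a product; then in `x`. -/
theorem lintegral_cyclic_le {G₁ G₂ G₃ : ℝ × ℝ → ENNReal} (h₁ : Measurable G₁)
    (h₂ : Measurable G₂) (h₃ : Measurable G₃) :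
    ∫⁻ p : ℝ × ℝ × ℝ, G₁ (p.1, p.2.1) * (G₂ (p.2.1, p.2.2) * G₃ (p.2.2, p.1)) ≤
      (∫⁻ x, G₁ x ^ 2) ^ (1 / 2 : ℝ) * (∫⁻ x, G₂ x ^ 2) ^ (1 / 2 : ℝ) *
        (∫⁻ x, G₃ x ^ 2) ^ (1 / 2 : ℝ) := by
  have hv2 : (volume : Measure (ℝ × ℝ)) = (volume : Measure ℝ).prod volume := rfl
  have hv3 : (volume : Measure (ℝ × ℝ × ℝ)) = (volume : Measure ℝ).prod volume := rfl
  have hmeas : Measurable fun p : ℝ × ℝ × ℝ =>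
      G₁ (p.1, p.2.1) * (G₂ (p.2.1, p.2.2) * G₃ (p.2.2, p.1)) := by fun_prop
  rw [hv3, lintegral_prod _ hmeas.aemeasurable]
  have hin : ∀ x : ℝ, ∫⁻ q : ℝ × ℝ, G₁ (x, q.1) * (G₂ (q.1, q.2) * G₃ (q.2, x)) ≤
      ((∫⁻ y, G₁ (x, y) ^ 2) ^ (1 / 2 : ℝ) * (∫⁻ z, G₃ (z, x) ^ 2) ^ (1 / 2 : ℝ)) *
        (∫⁻ q, G₂ q ^ 2) ^ (1 / 2 : ℝ) := by
    intro x
    have e : ∀ q : ℝ × ℝ, G₁ (x, q.1) * (G₂ (q.1, q.2) * G₃ (q.2, x)) =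
        (G₁ (x, q.1) * G₃ (q.2, x)) * G₂ q := fun q => by rw [Prod.mk.eta]; ring
    simp_rw [e]
    refine (lintegral_mul_le_sqrt _ (by fun_prop) (by fun_prop)).trans (le_of_eq ?_)
    simp_rw [mul_pow]
    rw [hv2, lintegral_prod_mul (f := fun y => G₁ (x, y) ^ 2) (g := fun z => G₃ (z, x) ^ 2)
      (by fun_prop) (by fun_prop), ENNReal.mul_rpow_of_nonneg _ _ (by norm_num)]
  have m1 : Measurable fun x : ℝ => ∫⁻ y, G₁ (x, y) ^ 2 :=
    Measurable.lintegral_prod_right' (f := fun p : ℝ × ℝ => G₁ p ^ 2) (by fun_prop)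
  have m3 : Measurable fun x : ℝ => ∫⁻ z, G₃ (z, x) ^ 2 :=
    Measurable.lintegral_prod_left' (f := fun p : ℝ × ℝ => G₃ p ^ 2) (by fun_prop)
  refine (lintegral_mono hin).trans ?_
  rw [lintegral_mul_const _ (by fun_prop)]
  have := lintegral_mul_le_sqrt (volume : Measure ℝ)
    (f := fun x => (∫⁻ y, G₁ (x, y) ^ 2) ^ (1 / 2 : ℝ))
    (g := fun x => (∫⁻ z, G₃ (z, x) ^ 2) ^ (1 / 2 : ℝ)) (by fun_prop) (by fun_prop)
  simp_rw [ENNReal.rpow_half_sq] at this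
  rw [← lintegral_prod (fun p : ℝ × ℝ => G₁ p ^ 2) (by fun_prop), ←
    lintegral_prod_symm (fun p : ℝ × ℝ => G₃ p ^ 2) (by fun_prop), ← hv2] at this
  refine (mul_le_mul_left this _).trans (le_of_eq ?_)
  ring

theorem integrable_cyclic {g₁ g₂ g₃ : ℝ × ℝ → ℝ} (m₁ : Measurable g₁) (m₂ : Measurable g₂)
    (m₃ : Measurable g₃) (h₁ : MemLp g₁ 2) (h₂ : MemLp g₂ 2) (h₃ : MemLp g₃ 2) :
    Integrable (fun p : ℝ × ℝ × ℝ => g₁ (p.1, p.2.1) * (g₂ (p.2.1, p.2.2) * g₃ (p.2.2, p.1))) ∧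
    |∫ p : ℝ × ℝ × ℝ, g₁ (p.1, p.2.1) * (g₂ (p.2.1, p.2.2) * g₃ (p.2.2, p.1))| ≤
      (eLpNorm g₁ 2).toReal * (eLpNorm g₂ 2).toReal * (eLpNorm g₃ 2).toReal := by
  have hle : ∫⁻ p : ℝ × ℝ × ℝ, ‖g₁ (p.1, p.2.1) * (g₂ (p.2.1, p.2.2) * g₃ (p.2.2, p.1))‖ₑ ≤
      eLpNorm g₁ 2 * eLpNorm g₂ 2 * eLpNorm g₃ 2 := by
    have := lintegral_cyclic_le m₁.enorm m₂.enorm m₃.enorm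
    simp_rw [enorm_mul]
    refine this.trans (le_of_eq ?_)
    simp [eLpNorm_eq_lintegral_rpow_enorm_toReal]
  have hfin : eLpNorm g₁ 2 * eLpNorm g₂ 2 * eLpNorm g₃ 2 ≠ ⊤ :=
    ENNReal.mul_ne_top (ENNReal.mul_ne_top h₁.2.ne h₂.2.ne) h₃.2.ne
  refine ⟨⟨by fun_prop, lt_of_le_of_lt hle hfin.lt_top⟩, ?_⟩
  rw [← ENNReal.toReal_mul, ← ENNReal.toReal_mul, ← Real.norm_eq_abs, ← toReal_enorm]
  exact ENNReal.toReal_mono hfin ((enorm_integral_le_lintegral_enorm _).trans hle)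

/-- The cyclic integral is continuous on `L²`. -/
theorem tendsto_cyclicIntegral {g : ℕ → ℝ × ℝ → ℝ} {f : ℝ × ℝ → ℝ} (mg : ∀ k, Measurable (g k))
    (mf : Measurable f) (hg : ∀ k, MemLp (g k) 2) (hf : MemLp f 2)
    (h : Tendsto (fun k => eLpNorm (fun x => g k x - f x) 2) atTop (𝓝 0)) :
    Tendsto (fun k => cyclicIntegral (g k)) atTop (𝓝 (cyclicIntegral f)) := by
  have hN := tendsto_toReal_eLpNorm_of_tendsto_sub hg hf h
  have hd : Tendsto (fun k => (eLpNorm (fun x => g k x - f x) 2).toReal) atTop (𝓝 0) := by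
    simpa [Function.comp_def] using (ENNReal.tendsto_toReal ENNReal.zero_ne_top).comp h
  have hlim := ((hd.mul hN).mul hN).add
    (((hd.const_mul (eLpNorm f 2).toReal).mul hN).add
      (hd.const_mul ((eLpNorm f 2).toReal * (eLpNorm f 2).toReal)))
  simp only [zero_mul, mul_zero, add_zero] at hlim
  rw [tendsto_iff_dist_tendsto_zero]
  refine squeeze_zero (fun _ => dist_nonneg) (fun k => ?_) hlim
  have mh : Measurable fun x => g k x - f x := (mg k).sub mf
  have hh : MemLp (fun x => g k x - f x) 2 := (hg k).sub hf
  obtain ⟨i1, b1⟩ := integrable_cyclic mh (mg k) (mg k) hh (hg k) (hg k)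
  obtain ⟨i2, b2⟩ := integrable_cyclic mf mh (mg k) hf hh (hg k)
  obtain ⟨i3, b3⟩ := integrable_cyclic mf mf mh hf hf hh
  -- Telescoping: `g k` is replaced by `f` one factor at a time, so each term contains one
  -- difference that is small in `L²`.
  have e : cyclicIntegral (g k) - cyclicIntegral f =
      (∫ p : ℝ × ℝ × ℝ, (g k (p.1, p.2.1) - f (p.1, p.2.1)) *
        (g k (p.2.1, p.2.2) * g k (p.2.2, p.1))) +
      ((∫ p : ℝ × ℝ × ℝ, f (p.1, p.2.1) *
        ((g k (p.2.1, p.2.2) - f (p.2.1, p.2.2)) * g k (p.2.2, p.1))) +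
      ∫ p : ℝ × ℝ × ℝ, f (p.1, p.2.1) *
        (f (p.2.1, p.2.2) * (g k (p.2.2, p.1) - f (p.2.2, p.1)))) := by
    have e1 := integral_add i1 (i2.add i3)
    have e2 := integral_add i2 i3
    simp only [Pi.add_apply] at e1 e2
    rw [← e2, ← e1, cyclicIntegral, cyclicIntegral,
      ← integral_sub (integrable_cyclic (mg k) (mg k) (mg k) (hg k) (hg k) (hg k)).1
      (integrable_cyclic mf mf mf hf hf hf).1]
    refine integral_congr_ae (.of_forall fun p => ?_)
    simp only []
    ring
  rw [Real.dist_eq, e]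
  exact (abs_add_le _ _).trans (add_le_add b1 ((abs_add_le _ _).trans (add_le_add b2 b3)))

theorem measurable_symmetrize {g : ℝ × ℝ → ℝ} (hg : Measurable g) : Measurable (symmetrize g) := by
  unfold symmetrize
  fun_prop

theorem OffDiagSimple.measurable_toFun (φ : OffDiagSimple) : Measurable φ.toFun := by
  unfold OffDiagSimple.toFun
  refine Finset.measurable_sum _ fun i _ => Finset.measurable_sum _ fun j _ =>
    Measurable.const_mul ?_ _
  exact (((measurable_const.indicator (φ.set i).2.1).comp measurable_fst).mul
      ((measurable_const.indicator (φ.set j).2.1).comp measurable_snd))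

/-- The second and third moments of a double Wiener–Itô integral with symmetric kernel. -/
theorem IsDoubleWienerIto.moments {Ω : Type*} [MeasurableSpace Ω] {P : Measure Ω}
    [IsProbabilityMeasure P] {B : FiniteBorel → Ω → ℝ} (hB : IsBrownianRandomMeasure P B)
    {f : ℝ × ℝ → ℝ} (mf : Measurable f) (hsymm : ∀ x, f x.swap = f x) {Z : Ω → ℝ}
    (hZ : IsDoubleWienerIto P B f Z) :
    (Integrable (fun ω => Z ω ^ 2) P ∧ ∫ ω, Z ω ^ 2 ∂P = 2 * ∫ x, f x ^ 2) ∧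
    (Integrable (fun ω => Z ω ^ 3) P ∧ ∫ ω, Z ω ^ 3 ∂P = 8 * cyclicIntegral f) := by
  obtain ⟨hf, hZ2, φ, hφ, hI⟩ := hZ
  have hS : ∀ k, MemLp (symmetrize (φ k).toFun) 2 := fun k => memLp_symmetrize (φ k).memLp_toFun
  have hSlim : Tendsto (fun k => eLpNorm (fun x => symmetrize (φ k).toFun x - f x) 2) atTop
      (𝓝 0) := by
    refine tendsto_of_tendsto_of_tendsto_of_le_of_le tendsto_const_nhds hφ (fun _ => zero_le)
      fun k => ?_
    have := eLpNorm_symmetrize_le ((φ k).memLp_toFun.sub hf)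
    simp only [Pi.sub_def] at this
    rwa [symmetrize_sub, symmetrize_of_comp_swap hsymm] at this
  have hQ : ∀ k, MemLp ((φ k).integral B) 2 P := fun k => by
    have hm := (φ k).moments_integral hB
    have h1 := hm.1 1
    simp only [pow_one] at h1
    exact (memLp_two_iff_integrable_sq h1.1).2 (hm.1 2)
  have hsq := tendsto_integral_sq_of_tendsto_sub hS hf hSlim
  refine ⟨⟨hZ2.integrable_sq, ?_⟩, ?_⟩
  · have h1 := tendsto_integral_sq_of_tendsto_sub hQ hZ2 hI
    simp_rw [fun k => ((φ k).moments_integral hB).2.1] at h1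
    exact tendsto_nhds_unique h1 (hsq.const_mul 2)
  -- The squared norms converge, hence are bounded, and this makes the fourth moments uniformly
  -- bounded.
  · obtain ⟨C, hC⟩ := hsq.bddAbove_range
    have hC' : ∀ k, ∫ x, symmetrize (φ k).toFun x ^ 2 ≤ C := fun k => hC ⟨k, rfl⟩
    obtain ⟨h3, h4⟩ := tendsto_integral_cube hQ hZ2 (C := 60 * C ^ 2)
      (fun k => ((φ k).moments_integral hB).1 4)
      (fun k => (((φ k).moments_integral hB).2.2.2).trans (by
        have : 0 ≤ ∫ x, symmetrize (φ k).toFun x ^ 2 := integral_nonneg fun _ => sq_nonneg _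
        have := hC' k
        gcongr)) hI
    refine ⟨h3, ?_⟩
    simp_rw [fun k => ((φ k).moments_integral hB).2.2.1] at h4
    exact tendsto_nhds_unique h4 ((tendsto_cyclicIntegral
      (fun k => measurable_symmetrize (φ k).measurable_toFun) mf hS hf hSlim).const_mul 8)

/-! ### Density of the elementary integrands and existence of the double integral -/

namespace OffDiagSimple

theorem toFun_of_mem (φ : OffDiagSimple) {x : ℝ × ℝ} {a b : Fin φ.n} (ha : x.1 ∈ (φ.set a).1)
    (hb : x.2 ∈ (φ.set b).1) : φ.toFun x = φ.coeff a b := by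
  have hne : ∀ {y : ℝ} {c i : Fin φ.n}, y ∈ (φ.set c).1 → i ≠ c →
      (φ.set i).1.indicator (fun _ => (1 : ℝ)) y = 0 := fun hy hi =>
    Set.indicator_of_notMem (fun h => Set.disjoint_left.1 (φ.disjoint _ _ hi) h hy) _
  rw [toFun, Finset.sum_eq_single a, Finset.sum_eq_single b]
  · simp [ha, hb]
  · intro j _ hj; rw [hne hb hj]; simp
  · simp
  · intro i _ hi
    exact Finset.sum_eq_zero fun j _ => by rw [hne ha hi]; simp
  · simp

theorem toFun_of_forall_notMem (φ : OffDiagSimple) {x : ℝ × ℝ}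
    (h : (∀ a, x.1 ∉ (φ.set a).1) ∨ ∀ a, x.2 ∉ (φ.set a).1) : φ.toFun x = 0 := by
  refine Finset.sum_eq_zero fun i _ => Finset.sum_eq_zero fun j _ => ?_
  rcases h with h | h <;> simp [h]

/-- The step function that samples `g` at the corners of the off-diagonal squares of side
`1 / (n + 1)` in `[-K, K) × [-K, K)`. -/
noncomputable def sample (g : ℝ × ℝ → ℝ) (K n : ℕ) : OffDiagSimple where
  n := 2 * (K * (n + 1))
  set i := ⟨Set.Ico (((i : ℝ) - K * (n + 1)) / (n + 1)) (((i : ℝ) + 1 - K * (n + 1)) / (n + 1)),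
    measurableSet_Ico, by simp⟩
  disjoint i j hij := by
    rw [Set.disjoint_left]
    rintro y ⟨h1, h2⟩ ⟨h3, h4⟩
    have hn : (0 : ℝ) < n + 1 := by positivity
    rw [div_le_iff₀ hn] at h1 h3
    rw [lt_div_iff₀ hn] at h2 h4
    have a1 : (i : ℝ) < (j : ℝ) + 1 := by linarith
    have a2 : (j : ℝ) < (i : ℝ) + 1 := by linarith
    norm_cast at a1 a2
    exact hij (Fin.ext (by omega))
  coeff i j := if i = j then 0 else
    g (((i : ℝ) - K * (n + 1)) / (n + 1), ((j : ℝ) - K * (n + 1)) / (n + 1))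
  coeff_diag i := by simp

variable (g : ℝ × ℝ → ℝ) (K n : ℕ)

theorem mem_sample_set (i : Fin (sample g K n).n) (y : ℝ) :
    y ∈ ((sample g K n).set i).1 ↔ ((i : ℝ) - K * (n + 1)) / (n + 1) ≤ y ∧
      y < ((i : ℝ) + 1 - K * (n + 1)) / (n + 1) := Iff.rfl

theorem exists_mem_sample_set {y : ℝ} (hy : y ∈ Set.Ico (-K : ℝ) K) :
    ∃ a, y ∈ ((sample g K n).set a).1 := by
  have hn : (0 : ℝ) < n + 1 := by positivity
  have h0 : 0 ≤ (y + K) * (n + 1) := mul_nonneg (by linarith [hy.1]) hn.le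
  have h1 : (y + K) * (n + 1) < ((2 * (K * (n + 1)) : ℕ) : ℝ) := by
    push_cast
    nlinarith [hy.2]
  -- Cell `i` starts at `-K + i / (n + 1)`, so the index is the floor of the rescaled distance from
  -- `-K`.
  refine ⟨⟨⌊(y + K) * (n + 1)⌋₊, (Nat.floor_lt h0).2 h1⟩, (mem_sample_set g K n _ _).2 ?_⟩
  have f1 := Nat.floor_le h0
  have f2 := Nat.lt_floor_add_one ((y + K) * (n + 1))
  simp only
  constructor
  · rw [div_le_iff₀ hn]; linarith
  · rw [lt_div_iff₀ hn]; linarith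

theorem notMem_sample_set {y : ℝ} (hy : y ∉ Set.Ico (-K : ℝ) K) (a) :
    y ∉ ((sample g K n).set a).1 := by
  have hn : (0 : ℝ) < n + 1 := by positivity
  rw [mem_sample_set, div_le_iff₀ hn, lt_div_iff₀ hn]
  rintro ⟨h1, h2⟩
  refine hy ⟨?_, ?_⟩
  · have : (0 : ℝ) ≤ (a : ℝ) := Nat.cast_nonneg _
    by_contra! h
    nlinarith
  · have h3 : (a : ℕ) + 1 ≤ 2 * (K * (n + 1)) := a.2
    have : ((a : ℕ) : ℝ) + 1 ≤ 2 * (K * (n + 1)) := by exact_mod_cast h3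
    by_contra! h
    nlinarith

theorem sample_toFun_of_notMem {x : ℝ × ℝ}
    (hx : x ∉ Set.Ico (-K : ℝ) K ×ˢ Set.Ico (-K : ℝ) K) : (sample g K n).toFun x = 0 := by
  refine toFun_of_forall_notMem _ ?_
  rw [Set.mem_prod, not_and_or] at hx
  exact hx.imp (fun h => notMem_sample_set g K n h) (fun h => notMem_sample_set g K n h)

/-- The first alternative is a diagonal square, where the coefficient is forced to be zero; in the
second, `y` is the corner of the square containing `x`. -/
theorem sample_toFun_of_mem {x : ℝ × ℝ}
    (hx : x ∈ Set.Ico (-K : ℝ) K ×ˢ Set.Ico (-K : ℝ) K) :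
    ((sample g K n).toFun x = 0 ∧ |x.1 - x.2| < 1 / (n + 1)) ∨
      ∃ y : ℝ × ℝ, |y.1 - x.1| ≤ 1 / (n + 1) ∧ |y.2 - x.2| ≤ 1 / (n + 1) ∧
        (sample g K n).toFun x = g y := by
  have hn : (0 : ℝ) < n + 1 := by positivity
  obtain ⟨a, ha⟩ := exists_mem_sample_set g K n hx.1
  obtain ⟨b, hb⟩ := exists_mem_sample_set g K n hx.2
  rw [toFun_of_mem _ ha hb]
  have ha' := (mem_sample_set g K n _ _).1 ha
  have hb' := (mem_sample_set g K n _ _).1 hb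
  have e : ∀ c : ℝ, (c + 1 - K * (n + 1)) / (n + 1) = (c - K * (n + 1)) / (n + 1) + 1 / (n + 1) :=
    fun c => by ring
  rw [e] at ha' hb'
  by_cases hab : a = b
  · left
    subst hab
    refine ⟨(sample g K n).coeff_diag a, ?_⟩
    rw [abs_lt]
    constructor <;> linarith
  · right
    refine ⟨_, ?_, ?_, if_neg hab⟩
    · rw [abs_le]; constructor <;> simp only <;> linarith
    · rw [abs_le]; constructor <;> simp only <;> linarith

theorem sample_toFun_abs_le {M : ℝ} (hM : ∀ x, |g x| ≤ M) (x : ℝ × ℝ) :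
    |(sample g K n).toFun x| ≤ M := by
  have h0 : 0 ≤ M := (abs_nonneg _).trans (hM 0)
  by_cases hx : x ∈ Set.Ico (-K : ℝ) K ×ˢ Set.Ico (-K : ℝ) K
  · rcases sample_toFun_of_mem g K n hx with h | ⟨y, -, -, h⟩
    · rw [h.1]; simpa
    · rw [h]; exact hM y
  · rw [sample_toFun_of_notMem g K n hx]; simpa

/-- The diagonal is null, so the zeros imposed on diagonal squares are invisible in the limit. -/
theorem ae_fst_ne_snd : ∀ᵐ x : ℝ × ℝ, x.1 ≠ x.2 := by
  have hm : MeasurableSet {x : ℝ × ℝ | x.1 = x.2} := measurableSet_eq_fun (by fun_prop) (by fun_prop)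
  rw [ae_iff]
  simp only [ne_eq, not_not]
  rw [Measure.volume_eq_prod, Measure.measure_prod_null hm]
  refine .of_forall fun x => ?_
  have : Prod.mk x ⁻¹' {x : ℝ × ℝ | x.1 = x.2} = {x} := by
    ext y; simp [eq_comm]
  simp only [this, measure_singleton, Pi.zero_apply]

theorem tendsto_eLpNorm_sample_sub {g : ℝ × ℝ → ℝ} (hg : Continuous g) (hc : HasCompactSupport g) :
    ∃ K : ℕ, Tendsto (fun n => eLpNorm (fun x => (sample g K n).toFun x - g x) 2) atTop (𝓝 0) := by
  obtain ⟨M, hM⟩ := hc.exists_bound_of_continuous hg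
  have hM' : ∀ x, |g x| ≤ M := hM
  obtain ⟨R, hR⟩ := hc.isBounded.subset_closedBall 0
  obtain ⟨K, hK⟩ := exists_nat_gt R
  have hg0 : ∀ x ∉ Set.Ico (-K : ℝ) K ×ˢ Set.Ico (-K : ℝ) K, g x = 0 := by
    intro x hx
    by_contra h
    have hx' := hR (subset_tsupport g h)
    rw [mem_closedBall_zero_iff] at hx'
    have h1 := (norm_fst_le x).trans hx'
    have h2 := (norm_snd_le x).trans hx'
    rw [Real.norm_eq_abs, abs_le] at h1 h2
    exact hx ⟨⟨by linarith, by linarith⟩, ⟨by linarith, by linarith⟩⟩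
  have hgm : MemLp g 2 := hg.memLp_of_hasCompactSupport hc
  have hm : ∀ n, MemLp (fun x => (sample g K n).toFun x - g x) 2 := fun n =>
    (sample g K n).memLp_toFun.sub hgm
  refine ⟨K, ?_⟩
  simp_rw [fun n => (hm n).eLpNorm_two_eq_sqrt]
  have key : Tendsto (fun n => ∫ x, ((sample g K n).toFun x - g x) ^ 2) atTop
      (𝓝 (∫ _ : ℝ × ℝ, (0 : ℝ))) := by
    refine tendsto_integral_of_dominated_convergence
      ((Set.Ico (-K : ℝ) K ×ˢ Set.Ico (-K : ℝ) K).indicator fun _ => (2 * M) ^ 2)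
      (fun n => ((hm n).1.pow 2)) ?_ (fun n => .of_forall fun x => ?_) ?_
    · rw [integrable_indicator_iff (measurableSet_Ico.prod measurableSet_Ico)]
      refine integrableOn_const ?_
      rw [Measure.volume_eq_prod, Measure.prod_prod]
      simp [ENNReal.mul_eq_top]
    · by_cases hx : x ∈ Set.Ico (-K : ℝ) K ×ˢ Set.Ico (-K : ℝ) K
      · rw [Set.indicator_of_mem hx, Real.norm_eq_abs, abs_pow]
        gcongr
        calc _ ≤ |(sample g K n).toFun x| + |g x| := abs_sub _ _
          _ ≤ M + M := add_le_add (sample_toFun_abs_le g K n hM' x) (hM' x)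
          _ = 2 * M := by ring
      · rw [Set.indicator_of_notMem hx, sample_toFun_of_notMem g K n hx, hg0 x hx]
        simp
    · filter_upwards [ae_fst_ne_snd] with x hne
      by_cases hx : x ∈ Set.Ico (-K : ℝ) K ×ˢ Set.Ico (-K : ℝ) K
      · have hinv : Tendsto (fun n : ℕ => (1 : ℝ) / (n + 1)) atTop (𝓝 0) :=
          tendsto_one_div_add_atTop_nhds_zero_nat
        have h1 : Tendsto (fun n => (sample g K n).toFun x) atTop (𝓝 (g x)) := by
          rw [Metric.tendsto_atTop]
          intro ε hε
          obtain ⟨δ, hδ, hcont⟩ := Metric.continuous_iff.1 hg x ε hε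
          -- A mesh below `δ` controls the sampled value; a mesh below `|x.1 - x.2|` keeps `x` out
          -- of the diagonal squares.
          have hpos : 0 < min δ |x.1 - x.2| := lt_min hδ (abs_pos.2 (sub_ne_zero.2 hne))
          obtain ⟨N, hN⟩ := eventually_atTop.1 (hinv.eventually_lt_const hpos)
          refine ⟨N, fun n hn => ?_⟩
          have hlt := hN n hn
          rcases sample_toFun_of_mem g K n hx with h | ⟨y, hy1, hy2, h⟩
          · exact absurd (h.2.trans hlt) (not_lt.2 (min_le_right _ _))
          · rw [h]
            refine hcont y ?_
            rw [Prod.dist_eq, Real.dist_eq, Real.dist_eq]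
            exact lt_of_le_of_lt (max_le hy1 hy2) (hlt.trans_le (min_le_left _ _))
        have := (h1.sub_const (g x)).pow 2
        simpa using this
      · simp_rw [fun n => sample_toFun_of_notMem g K n hx, hg0 x hx]
        simp
  have := ENNReal.tendsto_ofReal (key.sqrt)
  simpa using this

/-- The elementary integrands are dense in `L²(ℝ²)`. -/
theorem exists_tendsto {f : ℝ × ℝ → ℝ} (hf : MemLp f 2) : ∃ φ : ℕ → OffDiagSimple,
    Tendsto (fun k => eLpNorm (fun x => (φ k).toFun x - f x) 2 volume) atTop (𝓝 0) := by
  have h : ∀ ε : ENNReal, ε ≠ 0 → ∃ φ : OffDiagSimple,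
      eLpNorm (fun x => φ.toFun x - f x) 2 ≤ ε := by
    intro ε hε
    obtain ⟨g, hc, hle, hg, hgm⟩ := hf.exists_hasCompactSupport_eLpNorm_sub_le (by norm_num)
      (ENNReal.half_pos hε).ne'
    obtain ⟨K, hK⟩ := tendsto_eLpNorm_sample_sub hg hc
    obtain ⟨n, hn⟩ := (hK.eventually_lt_const (ENNReal.half_pos hε)).exists
    refine ⟨sample g K n, ?_⟩
    have e : (fun x => (sample g K n).toFun x - f x) =
        (fun x => (sample g K n).toFun x - g x) - (f - g) := by
      ext x; simp
    rw [e]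
    refine (eLpNorm_sub_le ((sample g K n).memLp_toFun.sub hgm).1 (hf.sub hgm).1
      (by norm_num)).trans ?_
    exact (add_le_add hn.le hle).trans (ENNReal.add_halves ε).le
  choose φ hφ using fun k : ℕ => h ((k : ENNReal))⁻¹ (by simp)
  exact ⟨φ, tendsto_of_tendsto_of_tendsto_of_le_of_le tendsto_const_nhds
    ENNReal.tendsto_inv_nat_nhds_zero (fun _ => zero_le) hφ⟩

end OffDiagSimple

theorem dist_toLp_toLp {α : Type*} [MeasurableSpace α] {μ : Measure α} {a b : α → ℝ}
    (ha : MemLp a 2 μ) (hb : MemLp b 2 μ) :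
    dist (ha.toLp a) (hb.toLp b) = (eLpNorm (fun x => a x - b x) 2 μ).toReal := by
  rw [Lp.dist_edist, Lp.edist_toLp_toLp]
  rfl

/-- The double Wiener–Itô integral of a square integrable kernel exists. -/
theorem exists_isDoubleWienerIto {Ω : Type*} [MeasurableSpace Ω] {P : Measure Ω}
    [IsProbabilityMeasure P] {B : FiniteBorel → Ω → ℝ} (hB : IsBrownianRandomMeasure P B)
    {f : ℝ × ℝ → ℝ} (hf : MemLp f 2) : ∃ Z, IsDoubleWienerIto P B f Z := by
  obtain ⟨φ, hφ⟩ := OffDiagSimple.exists_tendsto hf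
  have hF : ∀ k, MemLp (φ k).toFun 2 := fun k => (φ k).memLp_toFun
  have hQ : ∀ k, MemLp ((φ k).integral B) 2 P := fun k => by
    have hm := (φ k).moments_integral hB
    have h1 := hm.1 1
    simp only [pow_one] at h1
    exact (memLp_two_iff_integrable_sq h1.1).2 (hm.1 2)
  -- The `√2` comes from the factor 2 in the isometry, and symmetrization does not increase the
  -- norm.
  have hdist : ∀ k l, dist ((hQ k).toLp _) ((hQ l).toLp _) ≤
      √2 * dist ((hF k).toLp _) ((hF l).toLp _) := by
    intro k l
    have hd : MemLp (fun x => (φ k).toFun x - (φ l).toFun x) 2 := (hF k).sub (hF l)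
    have hq : MemLp (fun ω => (φ k).integral B ω - (φ l).integral B ω) 2 P := (hQ k).sub (hQ l)
    rw [dist_toLp_toLp, dist_toLp_toLp, hq.eLpNorm_two_eq_sqrt, ENNReal.toReal_ofReal (Real.sqrt_nonneg _),
      ((φ k).integral_sub_sq (φ l) hB).2, ← (memLp_symmetrize hd).sq_toReal_eLpNorm_two,
      Real.sqrt_mul (by norm_num), Real.sqrt_sq ENNReal.toReal_nonneg]
    exact mul_le_mul_of_nonneg_left
      (ENNReal.toReal_mono hd.2.ne (eLpNorm_symmetrize_le hd)) (Real.sqrt_nonneg _)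
  have hFc : CauchySeq fun k => (hF k).toLp _ :=
    ((Lp.tendsto_Lp_iff_tendsto_eLpNorm'' _ hF f hf).2 hφ).cauchySeq
  have hQc : CauchySeq fun k => (hQ k).toLp _ := by
    rw [Metric.cauchySeq_iff] at hFc ⊢
    intro ε hε
    have h2 : 0 < √2 := by positivity
    obtain ⟨N, hN⟩ := hFc (ε / √2) (div_pos hε h2)
    refine ⟨N, fun m hm n hn => (hdist m n).trans_lt ?_⟩
    rw [mul_comm, ← lt_div_iff₀ h2]
    exact hN m hm n hn
  obtain ⟨Z, hZ⟩ := cauchySeq_tendsto_of_complete hQc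
  refine ⟨Z, hf, Lp.memLp Z, φ, hφ, ?_⟩
  have := (Lp.tendsto_Lp_iff_tendsto_eLpNorm'' _ hQ Z (Lp.memLp Z)).1 (by
    rw [Lp.toLp_coeFn]; exact hZ)
  exact this

/-! ### Beta integrals -/

/-- A restatement of the fact that the beta density has total mass one. -/
theorem lintegral_rpow_mul_one_sub_rpow {p q : ℝ} (hp : 0 < p) (hq : 0 < q) :
    ∫⁻ u in Ioo (0 : ℝ) 1, ENNReal.ofReal (u ^ (p - 1) * (1 - u) ^ (q - 1)) =
      ENNReal.ofReal (beta p q) := by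
  have hb := beta_pos hp hq
  have h := lintegral_betaPDF_eq_one hp hq
  rw [lintegral_betaPDF] at h
  have e : ∀ u : ℝ, ENNReal.ofReal (u ^ (p - 1) * (1 - u) ^ (q - 1)) = ENNReal.ofReal (beta p q) *
      ENNReal.ofReal (1 / beta p q * u ^ (p - 1) * (1 - u) ^ (q - 1)) := fun u => by
    rw [← ENNReal.ofReal_mul hb.le]
    congr 1
    field_simp
  simp_rw [e]
  rw [lintegral_const_mul' _ _ ENNReal.ofReal_ne_top, h, mul_one]

theorem lintegral_sub_rpow_mul_sub_rpow {p q r t : ℝ} (hp : 0 < p) (hq : 0 < q) (hrt : r < t) :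
    ∫⁻ s in Ioo r t, ENNReal.ofReal ((s - r) ^ (p - 1) * (t - s) ^ (q - 1)) =
      ENNReal.ofReal ((t - r) ^ (p + q - 1) * beta p q) := by
  have hh : 0 < t - r := sub_pos.2 hrt
  have himg : (fun w => r + (t - r) * w) '' Ioo 0 1 = Ioo r t := by
    ext s
    constructor
    · rintro ⟨w, ⟨h0, h1⟩, rfl⟩
      constructor <;> simp only <;> nlinarith
    · rintro ⟨h0, h1⟩
      refine ⟨(s - r) / (t - r), ⟨div_pos (by linarith) hh, (div_lt_one hh).2 (by linarith)⟩, ?_⟩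
      simp only
      field_simp
      ring
  rw [← himg, lintegral_image_eq_lintegral_abs_deriv_mul measurableSet_Ioo (f' := fun _ => t - r)
    (fun w _ => by
      have := ((hasDerivAt_id w).const_mul (t - r)).const_add r
      simpa using this.hasDerivWithinAt)
    (fun a _ b _ hab => by
      have hab' : r + (t - r) * a = r + (t - r) * b := hab
      exact mul_left_cancel₀ hh.ne' (by linarith)),
    ENNReal.ofReal_mul (by positivity), ← lintegral_rpow_mul_one_sub_rpow hp hq,
    ← lintegral_const_mul' _ _ ENNReal.ofReal_ne_top]
  refine setLIntegral_congr_fun measurableSet_Ioo fun w hw => ?_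
  have hw1 : 0 < 1 - w := by linarith [hw.2]
  rw [← ENNReal.ofReal_mul (abs_nonneg _), ← ENNReal.ofReal_mul (by positivity), abs_of_pos hh]
  congr 1
  rw [show r + (t - r) * w - r = (t - r) * w by ring,
    show t - (r + (t - r) * w) = (t - r) * (1 - w) by ring, Real.mul_rpow hh.le hw.1.le,
    Real.mul_rpow hh.le hw1.le, show p + q - 1 = (p - 1) + (q - 1) + 1 by ring,
    Real.rpow_add hh, Real.rpow_add hh, Real.rpow_one]
  ring

theorem beta_one_right {p : ℝ} (hp : 0 < p) : beta p 1 = 1 / p := by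
  rw [beta, Real.Gamma_one, Real.Gamma_add_one hp.ne']
  have := (Real.Gamma_pos_of_pos hp).ne'
  field_simp

theorem beta_one_left {p : ℝ} (hp : 0 < p) : beta 1 p = 1 / p := by
  rw [← beta_one_right hp, beta, beta, add_comm, mul_comm]

theorem lintegral_lintegral_sub_rpow {p : ℝ} (hp : 0 < p) :
    ∫⁻ s in Ioo (0 : ℝ) 1, ∫⁻ t in Ioo s 1, ENNReal.ofReal ((t - s) ^ (p - 1)) =
      ENNReal.ofReal (1 / (p * (p + 1))) := by
  -- The trivial factor `s ^ (1 - 1)` puts the outer integral in Beta form with first parameter 1.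
  have h1 : ∀ s ∈ Ioo (0 : ℝ) 1, ∫⁻ t in Ioo s 1, ENNReal.ofReal ((t - s) ^ (p - 1)) =
      ENNReal.ofReal (1 / p) *
        ENNReal.ofReal (s ^ ((1 : ℝ) - 1) * (1 - s) ^ ((p + 1) - 1)) := by
    intro s hs
    have := lintegral_sub_rpow_mul_sub_rpow hp one_pos hs.2
    simp only [sub_self, Real.rpow_zero, mul_one, beta_one_right hp] at this
    rw [this, ← ENNReal.ofReal_mul (by positivity)]
    congr 1
    simp only [sub_self, Real.rpow_zero, one_mul]
    ring
  rw [setLIntegral_congr_fun measurableSet_Ioo h1, lintegral_const_mul' _ _ ENNReal.ofReal_ne_top,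
    lintegral_rpow_mul_one_sub_rpow one_pos (by linarith), beta_one_left (by linarith),
    ← ENNReal.ofReal_mul (by positivity)]
  congr 1
  field_simp

/-! ### Convolutions of powers of the positive part -/

theorem measurable_posPow (c : ℝ) : Measurable fun u => posPow u c :=
  Measurable.ite measurableSet_Ioi (by fun_prop) measurable_const

theorem posPow_nonneg (u c : ℝ) : 0 ≤ posPow u c := by
  unfold posPow
  split_ifs with h
  · positivity
  · rfl

/-- The power of the positive part as an extended nonnegative number. -/
noncomputable def eposPow (c u : ℝ) : ENNReal := ENNReal.ofReal (posPow u c)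

@[fun_prop]
theorem measurable_eposPow (c : ℝ) : Measurable (eposPow c) := (measurable_posPow c).ennreal_ofReal

/-- The inner product of the functions `(s - ·)_+ ^ a` and `(t - ·)_+ ^ b`. -/
noncomputable def posPowInner (a b s t : ℝ) : ENNReal :=
  ∫⁻ x, eposPow a (s - x) * eposPow b (t - x)

theorem posPowInner_comm (a b s t : ℝ) : posPowInner a b s t = posPowInner b a t s := by
  simp only [posPowInner, mul_comm]

@[fun_prop]
theorem measurable_posPowInner (a b : ℝ) :
    Measurable fun p : ℝ × ℝ => posPowInner a b p.1 p.2 := by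
  unfold posPowInner
  exact Measurable.lintegral_prod_right'
    (f := fun q : (ℝ × ℝ) × ℝ => eposPow a (q.1.1 - q.2) * eposPow b (q.1.2 - q.2)) (by fun_prop)

/-- The substitution `w = (s - x) / (t - x)` carries `(-∞, s)` onto `(0, 1)` and produces a Beta
integral. `ha` gives convergence at `x = s`, `hab` at `-∞`. -/
theorem posPowInner_eq {a b s t : ℝ} (ha : -1 < a) (hab : a + b < -1) (hst : s < t) :
    posPowInner a b s t = ENNReal.ofReal ((t - s) ^ (a + b + 1) * beta (a + 1) (-a - b - 1)) := by
  have hh : 0 < t - s := sub_pos.2 hst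
  have h0 : posPowInner a b s t =
      ∫⁻ x in Iio s, ENNReal.ofReal ((s - x) ^ a * (t - x) ^ b) := by
    rw [posPowInner, ← lintegral_indicator measurableSet_Iio]
    congr 1
    ext x
    by_cases hx : x < s
    · rw [Set.indicator_of_mem (by exact hx), eposPow, eposPow,
        ← ENNReal.ofReal_mul (posPow_nonneg _ _), posPow, posPow, if_pos (by linarith),
        if_pos (by linarith)]
    · rw [Set.indicator_of_notMem (by exact hx), eposPow, posPow, if_neg (by linarith)]
      simp
  have himg : (fun w => s - (t - s) * (w / (1 - w))) '' Ioo 0 1 = Iio s := by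
    ext x
    constructor
    · rintro ⟨w, ⟨h0, h1⟩, rfl⟩
      have : 0 < w / (1 - w) := div_pos h0 (by linarith)
      have := mul_pos hh this
      simp only [mem_Iio]
      linarith
    · intro hx
      have hx' : x < s := hx
      have htx : 0 < t - x := by linarith
      refine ⟨(s - x) / (t - x), ⟨div_pos (by linarith) htx, (div_lt_one htx).2 (by linarith)⟩, ?_⟩
      simp only
      have : 1 - (s - x) / (t - x) = (t - s) / (t - x) := by field_simp; ring
      rw [this]
      field_simp
      ring
  rw [h0, ← himg, lintegral_image_eq_lintegral_abs_deriv_mul measurableSet_Ioo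
    (f' := fun w => -((t - s) * (1 / (1 - w) ^ 2)))
    (fun w hw => by
      have hw1 : 1 - w ≠ 0 := by linarith [hw.2]
      have h1 := (hasDerivAt_id w).div ((hasDerivAt_id w).const_sub 1) hw1
      have h2 := (h1.const_mul (t - s)).const_sub s
      refine (h2.congr_deriv ?_).hasDerivWithinAt
      simp only [id]
      field_simp
      ring)
    (fun u hu v hv huv => by
      have huv' : s - (t - s) * (u / (1 - u)) = s - (t - s) * (v / (1 - v)) := huv
      have hu1 : 1 - u ≠ 0 := by linarith [hu.2]
      have hv1 : 1 - v ≠ 0 := by linarith [hv.2]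
      have : u / (1 - u) = v / (1 - v) := mul_left_cancel₀ hh.ne' (by linarith)
      rw [div_eq_div_iff hu1 hv1] at this
      linarith),
    ENNReal.ofReal_mul (by positivity),
    ← lintegral_rpow_mul_one_sub_rpow (p := a + 1) (q := -a - b - 1) (by linarith) (by linarith),
    ← lintegral_const_mul' _ _ ENNReal.ofReal_ne_top]
  refine setLIntegral_congr_fun measurableSet_Ioo fun w hw => ?_
  have hw1 : 0 < 1 - w := by linarith [hw.2]
  have hw0 : 0 < w := hw.1
  rw [← ENNReal.ofReal_mul (abs_nonneg _), ← ENNReal.ofReal_mul (by positivity), abs_neg,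
    abs_of_pos (by positivity)]
  congr 1
  rw [show s - (s - (t - s) * (w / (1 - w))) = (t - s) * w * (1 - w)⁻¹ by
      rw [div_eq_mul_inv]; ring,
    show t - (s - (t - s) * (w / (1 - w))) = (t - s) * (1 - w)⁻¹ by field_simp; ring,
    Real.mul_rpow (by positivity) (by positivity), Real.mul_rpow hh.le hw0.le,
    Real.mul_rpow hh.le (by positivity), Real.inv_rpow hw1.le, Real.inv_rpow hw1.le,
    ← Real.rpow_neg hw1.le, ← Real.rpow_neg hw1.le, Real.rpow_add hh, Real.rpow_add hh,
    Real.rpow_one, add_sub_cancel_right, show -a - b - 1 - 1 = -a + -b + (-2 : ℝ) by ring,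
    Real.rpow_add hw1, Real.rpow_add hw1, Real.rpow_neg hw1.le 2, Real.rpow_two]
  ring

/-! ### Integrals of symmetric functions over the simplex -/

/-- The diagonal is negligible because `ν` has no atoms, and the swap exchanges the two triangles.
-/
theorem lintegral_lintegral_eq_two_mul {ν : Measure ℝ} [SFinite ν] [NullSingletonClass ν]
    {H : ℝ → ℝ → ENNReal} (hm : Measurable fun p : ℝ × ℝ => H p.1 p.2)
    (hs : ∀ s t, H s t = H t s) :
    ∫⁻ s, ∫⁻ t, H s t ∂ν ∂ν = 2 * ∫⁻ s, ∫⁻ t, (if s < t then H s t else 0) ∂ν ∂ν := by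
  have hm1 : Measurable fun p : ℝ × ℝ => if p.1 < p.2 then H p.1 p.2 else 0 :=
    Measurable.ite (measurableSet_lt measurable_fst measurable_snd) hm measurable_const
  have hm2 : Measurable fun p : ℝ × ℝ => if p.2 < p.1 then H p.2 p.1 else 0 :=
    hm1.comp measurable_swap
  have h1 : ∀ s, ∫⁻ t, H s t ∂ν = (∫⁻ t, (if s < t then H s t else 0) ∂ν) +
      ∫⁻ t, (if t < s then H t s else 0) ∂ν := by
    intro s
    have hm3 : Measurable fun t => if s < t then H s t else 0 := hm1.comp measurable_prodMk_left
    rw [← lintegral_add_left hm3]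
    refine lintegral_congr_ae ?_
    filter_upwards [Measure.ae_ne ν s] with t ht
    rcases lt_or_gt_of_ne ht with h | h
    · simp [h, h.not_gt, hs s t]
    · simp [h, h.not_gt]
  simp_rw [h1]
  rw [lintegral_add_left hm1.lintegral_prod_right',
    lintegral_lintegral_swap (f := fun s t => if t < s then H t s else 0) hm2.aemeasurable, two_mul]

/-- Away from ties `H` splits into six ordered pieces with equal integrals; the two transpositions
assumed generate all permutations. On the right the middle variable is innermost, ready for a Beta
integral over `(r, t)`. -/
theorem lintegral_lintegral_lintegral_eq_six_mul {ν : Measure ℝ} [SFinite ν] [NullSingletonClass ν]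
    {H : ℝ → ℝ → ℝ → ENNReal} (hm : Measurable fun p : ℝ × ℝ × ℝ => H p.1 p.2.1 p.2.2)
    (h12 : ∀ r s t, H r s t = H s r t) (h23 : ∀ r s t, H r s t = H r t s) :
    ∫⁻ r, ∫⁻ s, ∫⁻ t, H r s t ∂ν ∂ν ∂ν =
      6 * ∫⁻ r, ∫⁻ t, ∫⁻ s, (if r < s ∧ s < t then H r s t else 0) ∂ν ∂ν ∂ν := by
  set φ : ℝ → ℝ → ℝ → ENNReal := fun r s t => if r < s ∧ s < t then H r s t else 0 with hφ
  have mφ : Measurable fun p : ℝ × ℝ × ℝ => φ p.1 p.2.1 p.2.2 :=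
    Measurable.ite ((measurableSet_lt (f := fun p : ℝ × ℝ × ℝ => p.1) (g := fun p => p.2.1)
      (by fun_prop) (by fun_prop)).inter (measurableSet_lt (f := fun p : ℝ × ℝ × ℝ => p.2.1)
      (g := fun p => p.2.2) (by fun_prop) (by fun_prop))) hm measurable_const
  have swap23 : ∀ G : ℝ → ℝ → ℝ → ENNReal, (Measurable fun p : ℝ × ℝ × ℝ => G p.1 p.2.1 p.2.2) →
      ∫⁻ r, ∫⁻ s, ∫⁻ t, G r s t ∂ν ∂ν ∂ν = ∫⁻ r, ∫⁻ s, ∫⁻ t, G r t s ∂ν ∂ν ∂ν := fun G hG => by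
    refine lintegral_congr fun r => ?_
    exact lintegral_lintegral_swap (hG.comp measurable_prodMk_left).aemeasurable
  have swap12 : ∀ G : ℝ → ℝ → ℝ → ENNReal, (Measurable fun p : ℝ × ℝ × ℝ => G p.1 p.2.1 p.2.2) →
      ∫⁻ r, ∫⁻ s, ∫⁻ t, G r s t ∂ν ∂ν ∂ν = ∫⁻ r, ∫⁻ s, ∫⁻ t, G s r t ∂ν ∂ν ∂ν := fun G hG => by
    refine lintegral_lintegral_swap (f := fun r s => ∫⁻ t, G r s t ∂ν) ?_
    refine (Measurable.lintegral_prod_right'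
      (f := fun q : (ℝ × ℝ) × ℝ => G q.1.1 q.1.2 q.2) ?_).aemeasurable
    exact hG.comp (by fun_prop : Measurable fun q : (ℝ × ℝ) × ℝ => (q.1.1, q.1.2, q.2))
  have m2 : Measurable fun p : ℝ × ℝ × ℝ => φ p.1 p.2.2 p.2.1 :=
    mφ.comp (by fun_prop : Measurable fun p : ℝ × ℝ × ℝ => (p.1, p.2.2, p.2.1))
  have m3 : Measurable fun p : ℝ × ℝ × ℝ => φ p.2.1 p.1 p.2.2 :=
    mφ.comp (by fun_prop : Measurable fun p : ℝ × ℝ × ℝ => (p.2.1, p.1, p.2.2))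
  have m4 : Measurable fun p : ℝ × ℝ × ℝ => φ p.2.1 p.2.2 p.1 :=
    mφ.comp (by fun_prop : Measurable fun p : ℝ × ℝ × ℝ => (p.2.1, p.2.2, p.1))
  have m5 : Measurable fun p : ℝ × ℝ × ℝ => φ p.2.2 p.1 p.2.1 :=
    mφ.comp (by fun_prop : Measurable fun p : ℝ × ℝ × ℝ => (p.2.2, p.1, p.2.1))
  have m6 : Measurable fun p : ℝ × ℝ × ℝ => φ p.2.2 p.2.1 p.1 :=
    mφ.comp (by fun_prop : Measurable fun p : ℝ × ℝ × ℝ => (p.2.2, p.2.1, p.1))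
  have hsplit : ∀ r s t, r ≠ s → r ≠ t → s ≠ t →
      H r s t = φ r s t + (φ r t s + (φ s r t + (φ s t r + (φ t r s + φ t s r)))) := by
    intro r s t h1 h2 h3
    have e2 : H r t s = H r s t := (h23 r s t).symm
    have e3 : H s r t = H r s t := (h12 r s t).symm
    have e4 : H s t r = H r s t := by rw [← h23, e3]
    have e5 : H t r s = H r s t := by rw [← h12, e2]
    have e6 : H t s r = H r s t := by rw [← h12, e4]
    simp only [hφ, e2, e3, e4, e5, e6]
    rcases lt_or_gt_of_ne h1 with a | a <;> rcases lt_or_gt_of_ne h2 with b | b <;>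
      rcases lt_or_gt_of_ne h3 with c | c <;>
      first
      | (exfalso; linarith)
      | simp [a, b, c, a.not_gt, b.not_gt, c.not_gt]
  have hadd : ∀ G G' : ℝ → ℝ → ℝ → ENNReal,
      (Measurable fun p : ℝ × ℝ × ℝ => G p.1 p.2.1 p.2.2) →
      ∫⁻ r, ∫⁻ s, ∫⁻ t, (G r s t + G' r s t) ∂ν ∂ν ∂ν =
        (∫⁻ r, ∫⁻ s, ∫⁻ t, G r s t ∂ν ∂ν ∂ν) + ∫⁻ r, ∫⁻ s, ∫⁻ t, G' r s t ∂ν ∂ν ∂ν := by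
    intro G G' hG
    have a1 : ∀ r s, Measurable fun t => G r s t := fun r s =>
      hG.comp (by fun_prop : Measurable fun t => (r, s, t))
    have a2 : ∀ r, Measurable fun s => ∫⁻ t, G r s t ∂ν := fun r =>
      (hG.comp measurable_prodMk_left : Measurable fun q : ℝ × ℝ => G r q.1 q.2).lintegral_prod_right'
    have a3 : Measurable fun r => ∫⁻ s, ∫⁻ t, G r s t ∂ν ∂ν := by
      refine Measurable.lintegral_prod_right' (f := fun q : ℝ × ℝ => ∫⁻ t, G q.1 q.2 t ∂ν) ?_
      refine Measurable.lintegral_prod_right' (f := fun q : (ℝ × ℝ) × ℝ => G q.1.1 q.1.2 q.2) ?_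
      exact hG.comp (by fun_prop : Measurable fun q : (ℝ × ℝ) × ℝ => (q.1.1, q.1.2, q.2))
    simp_rw [fun r s => lintegral_add_left (a1 r s) (μ := ν) (fun t => G' r s t),
      fun r => lintegral_add_left (a2 r) (μ := ν) (fun s => ∫⁻ t, G' r s t ∂ν)]
    exact lintegral_add_left a3 _
  have hae : ∫⁻ r, ∫⁻ s, ∫⁻ t, H r s t ∂ν ∂ν ∂ν = ∫⁻ r, ∫⁻ s, ∫⁻ t,
      (φ r s t + (φ r t s + (φ s r t + (φ s t r + (φ t r s + φ t s r))))) ∂ν ∂ν ∂ν := by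
    refine lintegral_congr fun r => lintegral_congr_ae ?_
    filter_upwards [Measure.ae_ne ν r] with s hs
    refine lintegral_congr_ae ?_
    filter_upwards [Measure.ae_ne ν r, Measure.ae_ne ν s] with t h1 h2
    exact hsplit r s t hs.symm h1.symm h2.symm
  rw [hae, hadd φ _ mφ, hadd (fun r s t => φ r t s) _ m2, hadd (fun r s t => φ s r t) _ m3,
    hadd (fun r s t => φ s t r) _ m4, hadd (fun r s t => φ t r s) _ m5]
  have c2 := swap23 φ mφ
  have c3 := swap12 φ mφ
  have c4 := swap12 (fun r s t => φ r t s) m2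
  have c5 := swap23 (fun r s t => φ s r t) m3
  have c6 := swap23 (fun r s t => φ s t r) m4
  rw [← c5, ← c6, ← c4, ← c3, ← c2]
  ring

/-! ### The Rosenblatt kernel -/

/-- Lebesgue measure on the unit interval. -/
noncomputable abbrev unitMeasure : Measure ℝ := volume.restrict (Ioo 0 1)

/-- The integrand of the Rosenblatt kernel as an extended nonnegative number. -/
noncomputable def erosenblattIntegrand (γ : Fin 2 → ℝ) (x y s : ℝ) : ENNReal :=
  ∑ a, eposPow (γ a) (s - x) * eposPow (γ a.rev) (s - y)

/-- The Rosenblatt kernel, up to its constant, as an extended nonnegative number. -/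
noncomputable def erosenblattKernel (γ : Fin 2 → ℝ) (x y : ℝ) : ENNReal :=
  ∫⁻ s, erosenblattIntegrand γ x y s ∂unitMeasure

section

variable (γ : Fin 2 → ℝ)

theorem rosenblattIntegrand_nonneg (x : ℝ × ℝ) (s : ℝ) :
    0 ≤ rosenblattIntegrand (γ 0) (γ 1) x s :=
  add_nonneg (mul_nonneg (posPow_nonneg _ _) (posPow_nonneg _ _))
    (mul_nonneg (posPow_nonneg _ _) (posPow_nonneg _ _))

theorem ofReal_rosenblattIntegrand (x : ℝ × ℝ) (s : ℝ) :
    ENNReal.ofReal (rosenblattIntegrand (γ 0) (γ 1) x s) = erosenblattIntegrand γ x.1 x.2 s := by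
  rw [rosenblattIntegrand, ENNReal.ofReal_add
    (mul_nonneg (posPow_nonneg _ _) (posPow_nonneg _ _))
    (mul_nonneg (posPow_nonneg _ _) (posPow_nonneg _ _)), ENNReal.ofReal_mul (posPow_nonneg _ _),
    ENNReal.ofReal_mul (posPow_nonneg _ _), erosenblattIntegrand, Fin.sum_univ_two]
  rfl

theorem measurable_rosenblattIntegrand (x : ℝ × ℝ) :
    Measurable (rosenblattIntegrand (γ 0) (γ 1) x) := by
  have h : ∀ (c y : ℝ), Measurable fun s : ℝ => posPow (s - y) c := fun c y =>
    (measurable_posPow c).comp (by fun_prop)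
  exact ((h _ _).mul (h _ _)).add ((h _ _).mul (h _ _))

@[fun_prop]
theorem measurable_erosenblattIntegrand :
    Measurable fun p : ℝ × ℝ × ℝ => erosenblattIntegrand γ p.1 p.2.1 p.2.2 := by
  unfold erosenblattIntegrand
  fun_prop

@[fun_prop]
theorem measurable_erosenblattKernel :
    Measurable fun p : ℝ × ℝ => erosenblattKernel γ p.1 p.2 := by
  unfold erosenblattKernel erosenblattIntegrand
  exact Measurable.lintegral_prod_right' (f := fun q : (ℝ × ℝ) × ℝ =>
    ∑ a, eposPow (γ a) (q.2 - q.1.1) * eposPow (γ a.rev) (q.2 - q.1.2)) (by fun_prop)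

theorem unitMeasure_eq : volume.restrict (Ioc (0 : ℝ) 1) = unitMeasure :=
  Measure.restrict_congr_set Ioo_ae_eq_Ioc.symm

/-- Valid at every point: where the integral diverges, the Bochner integral and `ENNReal.toReal ⊤`
are both zero. Hence the kernel is measurable and symmetric everywhere. -/
theorem rosenblattKernel_eq (A : ℝ) (x : ℝ × ℝ) :
    rosenblattKernel A (γ 0) (γ 1) 1 x = A / 2 * (erosenblattKernel γ x.1 x.2).toReal := by
  rw [rosenblattKernel, intervalIntegral.integral_of_le zero_le_one, unitMeasure_eq,
    integral_eq_lintegral_of_nonneg_ae (.of_forall fun s => rosenblattIntegrand_nonneg γ x s)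
      (measurable_rosenblattIntegrand γ x).aestronglyMeasurable]
  simp_rw [ofReal_rosenblattIntegrand]
  rfl

theorem intervalIntegrable_rosenblattIntegrand {x : ℝ × ℝ}
    (hx : erosenblattKernel γ x.1 x.2 ≠ ⊤) :
    IntervalIntegrable (rosenblattIntegrand (γ 0) (γ 1) x) volume 0 1 := by
  rw [intervalIntegrable_iff_integrableOn_Ioc_of_le zero_le_one, IntegrableOn, unitMeasure_eq]
  refine ⟨(measurable_rosenblattIntegrand γ x).aestronglyMeasurable, ?_⟩
  rw [hasFiniteIntegral_iff_ofReal (.of_forall fun s => rosenblattIntegrand_nonneg γ x s)]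
  simp_rw [ofReal_rosenblattIntegrand]
  exact hx.lt_top

theorem erosenblattIntegrand_comm (x y s : ℝ) :
    erosenblattIntegrand γ x y s = erosenblattIntegrand γ y x s := by
  simp only [erosenblattIntegrand, Fin.sum_univ_two, Fin.rev_zero, Fin.reduceLast, Fin.reduceRev]
  ring

theorem erosenblattKernel_comm (x y : ℝ) :
    erosenblattKernel γ x y = erosenblattKernel γ y x := by
  simp only [erosenblattKernel, erosenblattIntegrand_comm γ x y]

theorem lintegral_erosenblattIntegrand_sq (s t : ℝ) :
    ∫⁻ x : ℝ × ℝ, erosenblattIntegrand γ x.1 x.2 s * erosenblattIntegrand γ x.1 x.2 t =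
      ∑ a, ∑ b, posPowInner (γ a) (γ b) s t * posPowInner (γ a.rev) (γ b.rev) s t := by
  have e : ∀ x : ℝ × ℝ, erosenblattIntegrand γ x.1 x.2 s * erosenblattIntegrand γ x.1 x.2 t =
      ∑ a, ∑ b, (eposPow (γ a) (s - x.1) * eposPow (γ b) (t - x.1)) *
        (eposPow (γ a.rev) (s - x.2) * eposPow (γ b.rev) (t - x.2)) := fun x => by
    rw [erosenblattIntegrand, erosenblattIntegrand, Finset.sum_mul_sum]
    exact Finset.sum_congr rfl fun _ _ => Finset.sum_congr rfl fun _ _ => by ring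
  simp_rw [e]
  rw [lintegral_finsetSum _ fun a _ => by fun_prop]
  refine Finset.sum_congr rfl fun a _ => ?_
  rw [lintegral_finsetSum _ fun a _ => by fun_prop]
  refine Finset.sum_congr rfl fun b _ => ?_
  exact lintegral_prod_mul (f := fun x => eposPow (γ a) (s - x) * eposPow (γ b) (t - x))
    (g := fun x => eposPow (γ a.rev) (s - x) * eposPow (γ b.rev) (t - x))
    (by fun_prop) (by fun_prop)

/-- Each space variable is shared by two of the three factors, hence contributes one inner product:
`a` meets `c.rev`, `a.rev` meets `b`, and `b.rev` meets `c`. -/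
theorem lintegral_erosenblattIntegrand_cyclic (r s t : ℝ) :
    ∫⁻ p : ℝ × ℝ × ℝ, erosenblattIntegrand γ p.1 p.2.1 r *
        (erosenblattIntegrand γ p.2.1 p.2.2 s * erosenblattIntegrand γ p.2.2 p.1 t) =
      ∑ a, ∑ b, ∑ c, posPowInner (γ a) (γ c.rev) r t *
        (posPowInner (γ a.rev) (γ b) r s * posPowInner (γ b.rev) (γ c) s t) := by
  have e : ∀ p : ℝ × ℝ × ℝ, erosenblattIntegrand γ p.1 p.2.1 r *
        (erosenblattIntegrand γ p.2.1 p.2.2 s * erosenblattIntegrand γ p.2.2 p.1 t) =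
      ∑ a, ∑ b, ∑ c, (eposPow (γ a) (r - p.1) * eposPow (γ c.rev) (t - p.1)) *
        ((eposPow (γ a.rev) (r - p.2.1) * eposPow (γ b) (s - p.2.1)) *
          (eposPow (γ b.rev) (s - p.2.2) * eposPow (γ c) (t - p.2.2))) := fun p => by
    simp only [erosenblattIntegrand]
    rw [Finset.sum_mul_sum, Finset.sum_mul_sum]
    refine Finset.sum_congr rfl fun _ _ => Finset.sum_congr rfl fun _ _ => ?_
    rw [Finset.mul_sum]
    exact Finset.sum_congr rfl fun _ _ => by ring
  simp_rw [e]
  rw [lintegral_finsetSum _ fun a _ => by fun_prop]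
  refine Finset.sum_congr rfl fun a _ => ?_
  rw [lintegral_finsetSum _ fun a _ => by fun_prop]
  refine Finset.sum_congr rfl fun b _ => ?_
  rw [lintegral_finsetSum _ fun a _ => by fun_prop]
  refine Finset.sum_congr rfl fun c _ => ?_
  have h1 := lintegral_prod_mul (μ := (volume : Measure ℝ)) (ν := (volume : Measure (ℝ × ℝ)))
    (f := fun x => eposPow (γ a) (r - x) * eposPow (γ c.rev) (t - x))
    (g := fun q : ℝ × ℝ => (eposPow (γ a.rev) (r - q.1) * eposPow (γ b) (s - q.1)) *
          (eposPow (γ b.rev) (s - q.2) * eposPow (γ c) (t - q.2))) (by fun_prop) (by fun_prop)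
  have h2 := lintegral_prod_mul (μ := (volume : Measure ℝ)) (ν := (volume : Measure ℝ))
    (f := fun x => eposPow (γ a.rev) (r - x) * eposPow (γ b) (s - x))
    (g := fun x => eposPow (γ b.rev) (s - x) * eposPow (γ c) (t - x)) (by fun_prop) (by fun_prop)
  refine h1.trans (congrArg _ ?_)
  exact h2

/-- Tonelli's theorem for the square of the kernel. -/
theorem lintegral_erosenblattKernel_sq :
    ∫⁻ x : ℝ × ℝ, erosenblattKernel γ x.1 x.2 ^ 2 = ∫⁻ s, ∫⁻ t,
      ∑ a, ∑ b, posPowInner (γ a) (γ b) s t * posPowInner (γ a.rev) (γ b.rev) s t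
      ∂unitMeasure ∂unitMeasure := by
  have e : ∀ x : ℝ × ℝ, erosenblattKernel γ x.1 x.2 ^ 2 = ∫⁻ s, ∫⁻ t,
      erosenblattIntegrand γ x.1 x.2 s * erosenblattIntegrand γ x.1 x.2 t
      ∂unitMeasure ∂unitMeasure := fun x => by
    rw [lintegral_lintegral_mul (by fun_prop) (by fun_prop), sq]
    rfl
  simp_rw [e]
  rw [lintegral_lintegral_swap (f := fun (x : ℝ × ℝ) (s : ℝ) => ∫⁻ t,
    erosenblattIntegrand γ x.1 x.2 s * erosenblattIntegrand γ x.1 x.2 t ∂unitMeasure)]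
  · refine lintegral_congr fun s => ?_
    rw [lintegral_lintegral_swap]
    · exact lintegral_congr fun t => lintegral_erosenblattIntegrand_sq γ s t
    · unfold Function.uncurry
      fun_prop
  · exact (Measurable.lintegral_prod_right' (f := fun q : ((ℝ × ℝ) × ℝ) × ℝ =>
      erosenblattIntegrand γ q.1.1.1 q.1.1.2 q.1.2 * erosenblattIntegrand γ q.1.1.1 q.1.1.2 q.2)
      (by fun_prop)).aemeasurable

/-- Tonelli's theorem for the cyclic product of three copies of the kernel. -/
theorem lintegral_erosenblattKernel_cyclic :
    ∫⁻ p : ℝ × ℝ × ℝ, erosenblattKernel γ p.1 p.2.1 *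
        (erosenblattKernel γ p.2.1 p.2.2 * erosenblattKernel γ p.2.2 p.1) =
      ∫⁻ r, ∫⁻ s, ∫⁻ t, ∑ a, ∑ b, ∑ c, posPowInner (γ a) (γ c.rev) r t *
        (posPowInner (γ a.rev) (γ b) r s * posPowInner (γ b.rev) (γ c) s t)
      ∂unitMeasure ∂unitMeasure ∂unitMeasure := by
  have e : ∀ p : ℝ × ℝ × ℝ, erosenblattKernel γ p.1 p.2.1 *
        (erosenblattKernel γ p.2.1 p.2.2 * erosenblattKernel γ p.2.2 p.1) =
      ∫⁻ r, ∫⁻ s, ∫⁻ t, erosenblattIntegrand γ p.1 p.2.1 r *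
        (erosenblattIntegrand γ p.2.1 p.2.2 s * erosenblattIntegrand γ p.2.2 p.1 t)
      ∂unitMeasure ∂unitMeasure ∂unitMeasure := fun p => by
    have h1 : ∀ x y r, erosenblattIntegrand γ x y r ≠ ⊤ := fun x y r => by
      simp [erosenblattIntegrand, eposPow, ENNReal.mul_eq_top]
    simp_rw [fun r s => lintegral_const_mul' (μ := unitMeasure) _ (fun t =>
      erosenblattIntegrand γ p.2.1 p.2.2 s * erosenblattIntegrand γ p.2.2 p.1 t)
      (h1 p.1 p.2.1 r),
      fun r => lintegral_const_mul' (μ := unitMeasure) _ (fun s => ∫⁻ t,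
        erosenblattIntegrand γ p.2.1 p.2.2 s * erosenblattIntegrand γ p.2.2 p.1 t ∂unitMeasure)
      (h1 p.1 p.2.1 r)]
    rw [lintegral_lintegral_mul (by fun_prop) (by fun_prop), lintegral_mul_const _ (by fun_prop)]
    rfl
  simp_rw [e]
  rw [lintegral_lintegral_swap (f := fun (p : ℝ × ℝ × ℝ) (r : ℝ) => ∫⁻ s, ∫⁻ t,
    erosenblattIntegrand γ p.1 p.2.1 r *
      (erosenblattIntegrand γ p.2.1 p.2.2 s * erosenblattIntegrand γ p.2.2 p.1 t)
      ∂unitMeasure ∂unitMeasure)]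
  · refine lintegral_congr fun r => ?_
    rw [lintegral_lintegral_swap]
    · refine lintegral_congr fun s => ?_
      rw [lintegral_lintegral_swap]
      · exact lintegral_congr fun t => lintegral_erosenblattIntegrand_cyclic γ r s t
      · unfold Function.uncurry
        fun_prop
    · exact (Measurable.lintegral_prod_right' (f := fun q : ((ℝ × ℝ × ℝ) × ℝ) × ℝ =>
        erosenblattIntegrand γ q.1.1.1 q.1.1.2.1 r *
          (erosenblattIntegrand γ q.1.1.2.1 q.1.1.2.2 q.1.2 *
            erosenblattIntegrand γ q.1.1.2.2 q.1.1.1 q.2)) (by fun_prop)).aemeasurable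
  · refine (Measurable.lintegral_prod_right' (f := fun q : ((ℝ × ℝ × ℝ) × ℝ) × ℝ => ∫⁻ t,
        erosenblattIntegrand γ q.1.1.1 q.1.1.2.1 q.1.2 *
          (erosenblattIntegrand γ q.1.1.2.1 q.1.1.2.2 q.2 *
            erosenblattIntegrand γ q.1.1.2.2 q.1.1.1 t) ∂unitMeasure) ?_).aemeasurable
    exact Measurable.lintegral_prod_right' (f := fun q : (((ℝ × ℝ × ℝ) × ℝ) × ℝ) × ℝ =>
        erosenblattIntegrand γ q.1.1.1.1 q.1.1.1.2.1 q.1.1.2 *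
          (erosenblattIntegrand γ q.1.1.1.2.1 q.1.1.1.2.2 q.1.2 *
            erosenblattIntegrand γ q.1.1.1.2.2 q.1.1.1.1 q.2)) (by fun_prop)

end

/-! ### The norm and the cyclic integral of the Rosenblatt kernel -/

/-- The common last step of both computations, with `p = 2 (γ 0 + γ 1) + 3` for the norm and `p = 3
(γ 0 + γ 1) + 5` for the cyclic integral. -/
theorem lintegral_lintegral_lt_rpow {H : ℝ → ℝ → ENNReal} {p C : ℝ} (hp : 0 < p) (hC : 0 ≤ C)
    (hH : ∀ s t, s < t → H s t = ENNReal.ofReal (C * (t - s) ^ (p - 1))) :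
    ∫⁻ s, ∫⁻ t, (if s < t then H s t else 0) ∂unitMeasure ∂unitMeasure =
      ENNReal.ofReal (C / (p * (p + 1))) := by
  have h : ∀ s ∈ Ioo (0 : ℝ) 1, ∫⁻ t, (if s < t then H s t else 0) ∂unitMeasure =
      ENNReal.ofReal C * ∫⁻ t in Ioo s 1, ENNReal.ofReal ((t - s) ^ (p - 1)) := by
    intro s hs
    rw [← lintegral_const_mul' _ _ ENNReal.ofReal_ne_top, ← lintegral_indicator measurableSet_Ioo,
      ← lintegral_indicator measurableSet_Ioo]
    refine lintegral_congr fun t => ?_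
    by_cases ht : t ∈ Ioo s 1
    · have ht' : t ∈ Ioo (0 : ℝ) 1 := ⟨hs.1.trans ht.1, ht.2⟩
      rw [indicator_of_mem ht, indicator_of_mem ht', if_pos ht.1, hH s t ht.1,
        ENNReal.ofReal_mul hC]
    · rw [indicator_of_notMem ht]
      by_cases ht' : t ∈ Ioo (0 : ℝ) 1
      · rw [indicator_of_mem ht', if_neg fun h => ht ⟨h, ht'.2⟩]
      · rw [indicator_of_notMem ht']
  rw [setLIntegral_congr_fun measurableSet_Ioo h, lintegral_const_mul' _ _ ENNReal.ofReal_ne_top,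
    lintegral_lintegral_sub_rpow hp, ← ENNReal.ofReal_mul hC, mul_one_div]

section

variable {γ : Fin 2 → ℝ}

/-- This is why all summands carry the same power of the time gap. -/
theorem add_rev_eq (γ : Fin 2 → ℝ) (a : Fin 2) : γ a + γ a.rev = γ 0 + γ 1 := by
  fin_cases a
  · rfl
  · exact add_comm _ _

/-- The constant in the norm of the Rosenblatt kernel. -/
noncomputable def normConst (γ : Fin 2 → ℝ) : ℝ :=
  ∑ a, ∑ b, beta (γ a + 1) (-γ a - γ b - 1) * beta (γ a.rev + 1) (-γ a.rev - γ b.rev - 1)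

/-- The constant in the cyclic integral of the Rosenblatt kernel. -/
noncomputable def cyclicConst (γ : Fin 2 → ℝ) : ℝ :=
  ∑ a, ∑ b, ∑ c, beta (γ a + 1) (-γ a - γ (Fin.rev c) - 1) *
    beta (γ a.rev + 1) (-γ a.rev - γ b - 1) * beta (γ b.rev + 1) (-γ b.rev - γ c - 1) *
    beta (γ a.rev + γ b + 2) (γ b.rev + γ c + 2)

theorem beta_inner_pos (hγ : ∀ i, γ i ∈ Set.Ioo (-1 : ℝ) (-1 / 2)) (a b : Fin 2) :
    0 < beta (γ a + 1) (-γ a - γ b - 1) := by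
  have h1 := hγ a
  have h2 := hγ b
  exact beta_pos (by linarith [h1.1]) (by linarith [h1.2, h2.2])

theorem posPowInner_eq_of_mem (hγ : ∀ i, γ i ∈ Set.Ioo (-1 : ℝ) (-1 / 2)) (a b : Fin 2) {s t : ℝ}
    (hst : s < t) : posPowInner (γ a) (γ b) s t =
      ENNReal.ofReal ((t - s) ^ (γ a + γ b + 1) * beta (γ a + 1) (-γ a - γ b - 1)) :=
  posPowInner_eq (hγ a).1 (by linarith [(hγ a).2, (hγ b).2]) hst

theorem normConst_nonneg (hγ : ∀ i, γ i ∈ Set.Ioo (-1 : ℝ) (-1 / 2)) : 0 ≤ normConst γ :=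
  Finset.sum_nonneg fun _ _ => Finset.sum_nonneg fun _ _ =>
    (mul_pos (beta_inner_pos hγ _ _) (beta_inner_pos hγ _ _)).le

theorem lintegral_erosenblattKernel_sq_eq (hγ : ∀ i, γ i ∈ Set.Ioo (-1 : ℝ) (-1 / 2))
    (hsum : -3 / 2 < γ 0 + γ 1) :
    ∫⁻ x : ℝ × ℝ, erosenblattKernel γ x.1 x.2 ^ 2 = ENNReal.ofReal
      (2 * (normConst γ / ((2 * (γ 0 + γ 1) + 3) * (2 * (γ 0 + γ 1) + 3 + 1)))) := by
  rw [lintegral_erosenblattKernel_sq, lintegral_lintegral_eq_two_mul (by fun_prop),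
    lintegral_lintegral_lt_rpow (p := 2 * (γ 0 + γ 1) + 3) (C := normConst γ) (by linarith)
      (normConst_nonneg hγ), ENNReal.ofReal_mul (by norm_num)]
  · simp
  · intro s t hst
    have hh : 0 < t - s := sub_pos.2 hst
    rw [normConst, Finset.sum_mul, ENNReal.ofReal_sum_of_nonneg fun a _ => by
      refine mul_nonneg (Finset.sum_nonneg fun b _ => ?_) (by positivity)
      exact (mul_pos (beta_inner_pos hγ _ _) (beta_inner_pos hγ _ _)).le]
    refine Finset.sum_congr rfl fun a _ => ?_
    rw [Finset.sum_mul, ENNReal.ofReal_sum_of_nonneg fun b _ =>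
      mul_nonneg (mul_pos (beta_inner_pos hγ _ _) (beta_inner_pos hγ _ _)).le (by positivity)]
    refine Finset.sum_congr rfl fun b _ => ?_
    have hb := beta_inner_pos hγ a b
    rw [posPowInner_eq_of_mem hγ a b hst, posPowInner_eq_of_mem hγ _ _ hst,
      ← ENNReal.ofReal_mul (by positivity),
      show 2 * (γ 0 + γ 1) + 3 - 1 = (γ a + γ b + 1) + (γ a.rev + γ b.rev + 1) by
        linarith [add_rev_eq γ a, add_rev_eq γ b], Real.rpow_add hh (γ a + γ b + 1)]
    congr 1
    ring
  -- Exchanging the times amounts to exchanging the summation indices `a` and `b`.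
  · intro s t
    refine (Finset.sum_congr rfl fun a _ => Finset.sum_congr rfl fun b _ => ?_).trans
      Finset.sum_comm
    rw [posPowInner_comm, posPowInner_comm (γ a.rev)]

/-- A transposition of the times permutes the eight summands: `(a, b, c)` goes to `(b.rev, a.rev,
c.rev)` for `r, s` and to `(a.rev, c.rev, b.rev)` for `s, t`. The symmetry is claimed for the whole
sum, not for single terms. -/
theorem cyclic_sum_symm (γ : Fin 2 → ℝ) (r s t : ℝ) :
    (∑ a, ∑ b, ∑ c, posPowInner (γ a) (γ (Fin.rev c)) r t *
        (posPowInner (γ a.rev) (γ b) r s * posPowInner (γ b.rev) (γ c) s t)) =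
      (∑ a, ∑ b, ∑ c, posPowInner (γ a) (γ (Fin.rev c)) s t *
        (posPowInner (γ a.rev) (γ b) s r * posPowInner (γ b.rev) (γ c) r t)) ∧
    (∑ a, ∑ b, ∑ c, posPowInner (γ a) (γ (Fin.rev c)) r t *
        (posPowInner (γ a.rev) (γ b) r s * posPowInner (γ b.rev) (γ c) s t)) =
      (∑ a, ∑ b, ∑ c, posPowInner (γ a) (γ (Fin.rev c)) r s *
        (posPowInner (γ a.rev) (γ b) r t * posPowInner (γ b.rev) (γ c) t s)) := by
  have h1 : ∀ a b, posPowInner (γ a) (γ b) s r = posPowInner (γ b) (γ a) r s := fun a b =>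
    posPowInner_comm _ _ _ _
  have h2 : ∀ a b, posPowInner (γ a) (γ b) t s = posPowInner (γ b) (γ a) s t := fun a b =>
    posPowInner_comm _ _ _ _
  have r0 : (0 : Fin 2).rev = 1 := rfl
  have r1 : (1 : Fin 2).rev = 0 := rfl
  simp only [Fin.sum_univ_two, r0, r1, h1, h2]
  constructor <;> ring

theorem beta_outer_pos (hγ : ∀ i, γ i ∈ Set.Ioo (-1 : ℝ) (-1 / 2)) (a b c d : Fin 2) :
    0 < beta (γ a + γ b + 2) (γ c + γ d + 2) :=
  beta_pos (by linarith [(hγ a).1, (hγ b).1]) (by linarith [(hγ c).1, (hγ d).1])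

theorem cyclicConst_summand_pos (hγ : ∀ i, γ i ∈ Set.Ioo (-1 : ℝ) (-1 / 2)) (a b c : Fin 2) :
    0 < beta (γ a + 1) (-γ a - γ (Fin.rev c) - 1) *
    beta (γ a.rev + 1) (-γ a.rev - γ b - 1) * beta (γ b.rev + 1) (-γ b.rev - γ c - 1) *
    beta (γ a.rev + γ b + 2) (γ b.rev + γ c + 2) :=
  mul_pos (mul_pos (mul_pos (beta_inner_pos hγ _ _) (beta_inner_pos hγ _ _))
    (beta_inner_pos hγ _ _)) (beta_outer_pos hγ _ _ _ _)

/-- Only two of the inner products depend on the middle time, and they are powers of `s - r` and `t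
- s`: this yields the fourth Beta factor. The exponents of the three gaps, plus one for the
integration, add up to `3 (γ 0 + γ 1) + 4`. -/
theorem lintegral_cyclic_summand (hγ : ∀ i, γ i ∈ Set.Ioo (-1 : ℝ) (-1 / 2)) (a b c : Fin 2)
    {r t : ℝ} (hrt : r < t) :
    ∫⁻ s in Ioo r t, posPowInner (γ a) (γ c.rev) r t *
        (posPowInner (γ a.rev) (γ b) r s * posPowInner (γ b.rev) (γ c) s t) =
      ENNReal.ofReal ((beta (γ a + 1) (-γ a - γ (Fin.rev c) - 1) *
        beta (γ a.rev + 1) (-γ a.rev - γ b - 1) * beta (γ b.rev + 1) (-γ b.rev - γ c - 1) *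
        beta (γ a.rev + γ b + 2) (γ b.rev + γ c + 2)) *
          (t - r) ^ (3 * (γ 0 + γ 1) + 5 - 1)) := by
  have hh : 0 < t - r := sub_pos.2 hrt
  have b1 := beta_inner_pos hγ a c.rev
  have b2 := beta_inner_pos hγ a.rev b
  have b3 := beta_inner_pos hγ b.rev c
  have b4 := beta_outer_pos hγ a.rev b b.rev c
  set β₁ := beta (γ a + 1) (-γ a - γ (Fin.rev c) - 1)
  set β₂ := beta (γ a.rev + 1) (-γ a.rev - γ b - 1)
  set β₃ := beta (γ b.rev + 1) (-γ b.rev - γ c - 1)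
  have h : ∀ s ∈ Ioo r t, posPowInner (γ a) (γ c.rev) r t *
        (posPowInner (γ a.rev) (γ b) r s * posPowInner (γ b.rev) (γ c) s t) =
      ENNReal.ofReal (β₁ * β₂ * β₃ * (t - r) ^ (γ a + γ c.rev + 1)) *
        ENNReal.ofReal ((s - r) ^ (γ a.rev + γ b + 2 - 1) *
          (t - s) ^ (γ b.rev + γ c + 2 - 1)) := by
    intro s hs
    have h1 : 0 < s - r := sub_pos.2 hs.1
    have h2 : 0 < t - s := sub_pos.2 hs.2
    rw [posPowInner_eq_of_mem hγ _ _ hrt, posPowInner_eq_of_mem hγ _ _ hs.1,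
      posPowInner_eq_of_mem hγ _ _ hs.2, ← ENNReal.ofReal_mul (by positivity),
      ← ENNReal.ofReal_mul (by positivity), ← ENNReal.ofReal_mul (by positivity),
      show γ a.rev + γ b + 2 - 1 = γ a.rev + γ b + 1 by ring,
      show γ b.rev + γ c + 2 - 1 = γ b.rev + γ c + 1 by ring]
    congr 1
    ring
  rw [setLIntegral_congr_fun measurableSet_Ioo h, lintegral_const_mul' _ _ ENNReal.ofReal_ne_top,
    lintegral_sub_rpow_mul_sub_rpow (by linarith [(hγ a.rev).1, (hγ b).1])
      (by linarith [(hγ b.rev).1, (hγ c).1]) hrt, ← ENNReal.ofReal_mul (by positivity),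
    show 3 * (γ 0 + γ 1) + 5 - 1 =
      (γ a + γ c.rev + 1) + (γ a.rev + γ b + 2 + (γ b.rev + γ c + 2) - 1) by
        linarith [add_rev_eq γ a, add_rev_eq γ b, add_rev_eq γ c],
    Real.rpow_add hh (γ a + γ c.rev + 1)]
  congr 1
  ring

theorem lintegral_erosenblattKernel_cyclic_eq (hγ : ∀ i, γ i ∈ Set.Ioo (-1 : ℝ) (-1 / 2))
    (hsum : -3 / 2 < γ 0 + γ 1) :
    ∫⁻ p : ℝ × ℝ × ℝ, erosenblattKernel γ p.1 p.2.1 *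
        (erosenblattKernel γ p.2.1 p.2.2 * erosenblattKernel γ p.2.2 p.1) = ENNReal.ofReal
      (6 * (cyclicConst γ / ((3 * (γ 0 + γ 1) + 5) * (3 * (γ 0 + γ 1) + 5 + 1)))) := by
  have hC : 0 ≤ cyclicConst γ := Finset.sum_nonneg fun _ _ => Finset.sum_nonneg fun _ _ =>
    Finset.sum_nonneg fun _ _ => (cyclicConst_summand_pos hγ _ _ _).le
  rw [lintegral_erosenblattKernel_cyclic, lintegral_lintegral_lintegral_eq_six_mul (by fun_prop)
    (fun r s t => (cyclic_sum_symm γ r s t).1) (fun r s t => (cyclic_sum_symm γ r s t).2),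
    ENNReal.ofReal_mul (by norm_num),
    ← lintegral_lintegral_lt_rpow (p := 3 * (γ 0 + γ 1) + 5) (C := cyclicConst γ)
      (H := fun r t => ∫⁻ s in Ioo r t, ∑ a, ∑ b, ∑ c, posPowInner (γ a) (γ (Fin.rev c)) r t *
        (posPowInner (γ a.rev) (γ b) r s * posPowInner (γ b.rev) (γ c) s t)) (by linarith) hC]
  · congr 1
    · simp
    refine setLIntegral_congr_fun measurableSet_Ioo fun r hr => ?_
    refine setLIntegral_congr_fun measurableSet_Ioo fun t ht => ?_
    by_cases hrt : r < t
    · simp only [if_pos hrt]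
      rw [← lintegral_indicator measurableSet_Ioo, ← lintegral_indicator measurableSet_Ioo]
      refine lintegral_congr fun s => ?_
      by_cases hs : s ∈ Ioo r t
      · have hs' : s ∈ Ioo (0 : ℝ) 1 := ⟨hr.1.trans hs.1, hs.2.trans ht.2⟩
        rw [indicator_of_mem hs, indicator_of_mem hs', if_pos (by exact hs)]
      · rw [indicator_of_notMem hs]
        by_cases hs' : s ∈ Ioo (0 : ℝ) 1
        · rw [indicator_of_mem hs', if_neg (by exact hs)]
        · rw [indicator_of_notMem hs']
    · simp only [if_neg hrt]
      refine (lintegral_congr fun s => if_neg fun h => hrt (h.1.trans h.2)).trans ?_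
      simp
  · intro r t hrt
    have hh : 0 < t - r := sub_pos.2 hrt
    have hpos := fun a b c : Fin 2 => mul_nonneg (cyclicConst_summand_pos hγ a b c).le
      (Real.rpow_nonneg hh.le (3 * (γ 0 + γ 1) + 5 - 1))
    have hm1 : ∀ b' b, Measurable fun s => posPowInner (γ b') (γ b) r s := fun b' b =>
      (measurable_posPowInner _ _).comp measurable_prodMk_left
    have hm2 : ∀ b' b, Measurable fun s => posPowInner (γ b') (γ b) s t := fun b' b =>
      (measurable_posPowInner _ _).comp (by fun_prop : Measurable fun s : ℝ => (s, t))
    have hm : ∀ a b c : Fin 2, Measurable fun s => posPowInner (γ a) (γ (Fin.rev c)) r t *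
        (posPowInner (γ a.rev) (γ b) r s * posPowInner (γ b.rev) (γ c) s t) := fun a b c =>
      ((hm1 _ _).mul (hm2 _ _)).const_mul _
    rw [lintegral_finsetSum _ fun a _ => Finset.measurable_sum _ fun b _ =>
      Finset.measurable_sum _ fun c _ => hm a b c]
    simp_rw [fun a => lintegral_finsetSum (μ := volume.restrict (Ioo r t)) Finset.univ fun b _ =>
      Finset.measurable_sum Finset.univ fun c _ => hm a b c,
      fun a b => lintegral_finsetSum (μ := volume.restrict (Ioo r t)) Finset.univ fun c _ =>
        hm a b c, fun a b c => lintegral_cyclic_summand hγ a b c hrt]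
    simp_rw [cyclicConst, Finset.sum_mul]
    rw [ENNReal.ofReal_sum_of_nonneg fun a _ => Finset.sum_nonneg fun b _ =>
      Finset.sum_nonneg fun c _ => hpos a b c]
    refine Finset.sum_congr rfl fun a _ => ?_
    rw [ENNReal.ofReal_sum_of_nonneg fun b _ => Finset.sum_nonneg fun c _ => hpos a b c]
    refine Finset.sum_congr rfl fun b _ => ?_
    rw [ENNReal.ofReal_sum_of_nonneg fun c _ => hpos a b c]

theorem sum_fin_three_arrow {κ : Type*} [Fintype κ] [DecidableEq κ] (g : κ → κ → κ → ℝ) :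
    ∑ σ : Fin 3 → κ, g (σ 0) (σ 1) (σ 2) = ∑ a, ∑ b, ∑ c, g a b c := by
  let e : (Fin 3 → κ) ≃ κ × κ × κ :=
    { toFun := fun σ => (σ 0, σ 1, σ 2)
      invFun := fun p => ![p.1, p.2.1, p.2.2]
      left_inv := fun σ => by ext i; fin_cases i <;> rfl
      right_inv := fun p => rfl }
  exact (Fintype.sum_equiv e (fun σ => g (σ 0) (σ 1) (σ 2)) (fun p => g p.1 p.2.1 p.2.2)
    fun σ => rfl).trans (by simp only [Fintype.sum_prod_type])

/-- Replacing both indices by their complements leaves a summand unchanged, so the four terms pair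
up. -/
theorem normConst_eq (γ : Fin 2 → ℝ) : normConst γ =
    2 * (beta (γ 0 + 1) (-γ 0 - γ 1 - 1) * beta (γ 1 + 1) (-γ 0 - γ 1 - 1) +
      beta (γ 0 + 1) (-2 * γ 0 - 1) * beta (γ 1 + 1) (-2 * γ 1 - 1)) := by
  have r0 : (0 : Fin 2).rev = 1 := rfl
  have r1 : (1 : Fin 2).rev = 0 := rfl
  simp only [normConst, Fin.sum_univ_two, r0, r1]
  rw [show -γ 1 - γ 0 - 1 = -γ 0 - γ 1 - 1 by ring, show -γ 0 - γ 0 - 1 = -2 * γ 0 - 1 by ring,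
    show -γ 1 - γ 1 - 1 = -2 * γ 1 - 1 by ring]
  ring

end

/-! ### The real-valued kernel: measurability, norm and cyclic integral. -/

section

variable {γ : Fin 2 → ℝ} (A : ℝ)

theorem measurable_rosenblattKernel : Measurable (rosenblattKernel A (γ 0) (γ 1) 1) := by
  rw [funext (rosenblattKernel_eq γ A)]
  exact (measurable_erosenblattKernel γ).ennreal_toReal.const_mul _

theorem integral_rosenblattKernel_sq (hγ : ∀ i, γ i ∈ Set.Ioo (-1 : ℝ) (-1 / 2))
    (hsum : -3 / 2 < γ 0 + γ 1) :
    MemLp (rosenblattKernel A (γ 0) (γ 1) 1) 2 ∧ ∫ x, rosenblattKernel A (γ 0) (γ 1) 1 x ^ 2 =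
      (A / 2) ^ 2 * (2 * (normConst γ / ((2 * (γ 0 + γ 1) + 3) * (2 * (γ 0 + γ 1) + 3 + 1)))) := by
  have h := lintegral_erosenblattKernel_sq_eq hγ hsum
  have e : ∀ x, rosenblattKernel A (γ 0) (γ 1) 1 x ^ 2 =
      (A / 2) ^ 2 * (erosenblattKernel γ x.1 x.2 ^ 2).toReal := fun x => by
    rw [rosenblattKernel_eq, mul_pow, ENNReal.toReal_pow]
  have hm : AEMeasurable (fun x : ℝ × ℝ => erosenblattKernel γ x.1 x.2 ^ 2) := by fun_prop
  have hfin : ∫⁻ x : ℝ × ℝ, erosenblattKernel γ x.1 x.2 ^ 2 ≠ ⊤ := by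
    rw [h]; exact ENNReal.ofReal_ne_top
  constructor
  · rw [memLp_two_iff_integrable_sq (measurable_rosenblattKernel A).aestronglyMeasurable]
    simp_rw [e]
    exact (integrable_toReal_of_lintegral_ne_top hm hfin).const_mul _
  · simp_rw [e]
    rw [integral_const_mul, integral_toReal hm (ae_lt_top' hm hfin), h, ENNReal.toReal_ofReal]
    have := normConst_nonneg hγ
    have h1 : 0 < 2 * (γ 0 + γ 1) + 3 := by linarith
    positivity

theorem cyclicIntegral_rosenblattKernel (hγ : ∀ i, γ i ∈ Set.Ioo (-1 : ℝ) (-1 / 2))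
    (hsum : -3 / 2 < γ 0 + γ 1) :
    cyclicIntegral (rosenblattKernel A (γ 0) (γ 1) 1) = (A / 2) ^ 3 *
      (6 * (cyclicConst γ / ((3 * (γ 0 + γ 1) + 5) * (3 * (γ 0 + γ 1) + 5 + 1)))) := by
  have h := lintegral_erosenblattKernel_cyclic_eq hγ hsum
  have e : ∀ p : ℝ × ℝ × ℝ, rosenblattKernel A (γ 0) (γ 1) 1 (p.1, p.2.1) *
      (rosenblattKernel A (γ 0) (γ 1) 1 (p.2.1, p.2.2) *
        rosenblattKernel A (γ 0) (γ 1) 1 (p.2.2, p.1)) =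
      (A / 2) ^ 3 * (erosenblattKernel γ p.1 p.2.1 *
        (erosenblattKernel γ p.2.1 p.2.2 * erosenblattKernel γ p.2.2 p.1)).toReal := fun p => by
    rw [rosenblattKernel_eq, rosenblattKernel_eq, rosenblattKernel_eq, ENNReal.toReal_mul,
      ENNReal.toReal_mul]
    ring
  have hm : AEMeasurable (fun p : ℝ × ℝ × ℝ => erosenblattKernel γ p.1 p.2.1 *
      (erosenblattKernel γ p.2.1 p.2.2 * erosenblattKernel γ p.2.2 p.1)) := by fun_prop
  have hfin : ∫⁻ p : ℝ × ℝ × ℝ, erosenblattKernel γ p.1 p.2.1 *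
      (erosenblattKernel γ p.2.1 p.2.2 * erosenblattKernel γ p.2.2 p.1) ≠ ⊤ := by
    rw [h]; exact ENNReal.ofReal_ne_top
  rw [cyclicIntegral]
  simp_rw [e]
  rw [integral_const_mul, integral_toReal hm (ae_lt_top' hm hfin), h, ENNReal.toReal_ofReal]
  have : 0 ≤ cyclicConst γ := Finset.sum_nonneg fun _ _ => Finset.sum_nonneg fun _ _ =>
    Finset.sum_nonneg fun _ _ => (cyclicConst_summand_pos hγ _ _ _).le
  have h1 : 0 < 3 * (γ 0 + γ 1) + 5 := by linarith
  positivity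

end

/-! ### The generalized Rosenblatt variable and its moments. -/

theorem theorem1 {Ω : Type*} [MeasurableSpace Ω] (P : Measure Ω) [IsProbabilityMeasure P]
    (B : FiniteBorel → Ω → ℝ) (hB : IsBrownianRandomMeasure P B)
    (A : ℝ) (γ : Fin 2 → ℝ) (hγ : ∀ i, γ i ∈ Set.Ioo (-1 : ℝ) (-1 / 2))
    (hsum : -3 / 2 < γ 0 + γ 1) :
    -- the kernel is defined almost everywhere, and the double integral exists
    (∀ᵐ x : ℝ × ℝ, IntervalIntegrable (rosenblattIntegrand (γ 0) (γ 1) x) volume 0 1) ∧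
    (∃ Z : Ω → ℝ, IsGenRosenblatt P B A (γ 0) (γ 1) 1 Z) ∧
    ∀ Z : Ω → ℝ, IsGenRosenblatt P B A (γ 0) (γ 1) 1 Z →
      -- second moment
      (Integrable (fun ω => Z ω ^ 2) P ∧
        ∫ ω, Z ω ^ 2 ∂P =
          A ^ 2 / ((γ 0 + γ 1 + 2) * (2 * (γ 0 + γ 1) + 3)) *
            (beta (γ 0 + 1) (-γ 0 - γ 1 - 1) * beta (γ 1 + 1) (-γ 0 - γ 1 - 1) +
              beta (γ 0 + 1) (-2 * γ 0 - 1) * beta (γ 1 + 1) (-2 * γ 1 - 1))) ∧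
      -- third moment; the complement of an index is its image under `Fin.rev`
      (Integrable (fun ω => Z ω ^ 3) P ∧
        ∫ ω, Z ω ^ 3 ∂P =
          2 * A ^ 3 / ((γ 0 + γ 1 + 2) * (3 * (γ 0 + γ 1) + 5)) *
            ∑ σ : Fin 3 → Fin 2,
              beta (γ (σ 0) + 1) (-γ (σ 0) - γ (σ 2).rev - 1) *
              beta (γ (σ 0).rev + 1) (-γ (σ 0).rev - γ (σ 1) - 1) *
              beta (γ (σ 1).rev + 1) (-γ (σ 1).rev - γ (σ 2) - 1) *
              beta (γ (σ 0).rev + γ (σ 1) + 2) (γ (σ 1).rev + γ (σ 2) + 2)) := by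
  have hL2 := integral_rosenblattKernel_sq A hγ hsum
  refine ⟨?_, exists_isDoubleWienerIto hB hL2.1, fun Z hZ => ?_⟩
  -- Square integrability makes the extended kernel finite almost everywhere, and finiteness is
  -- integrability of the nonnegative integrand.
  · have hm : AEMeasurable (fun x : ℝ × ℝ => erosenblattKernel γ x.1 x.2 ^ 2) := by fun_prop
    have hfin : ∫⁻ x : ℝ × ℝ, erosenblattKernel γ x.1 x.2 ^ 2 ≠ ⊤ := by
      rw [lintegral_erosenblattKernel_sq_eq hγ hsum]; exact ENNReal.ofReal_ne_top
    filter_upwards [ae_lt_top' hm hfin] with x hx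
    exact intervalIntegrable_rosenblattIntegrand γ fun h => by simp [h] at hx
  · have hsymm : ∀ x : ℝ × ℝ, rosenblattKernel A (γ 0) (γ 1) 1 x.swap =
        rosenblattKernel A (γ 0) (γ 1) 1 x := fun x => by
      rw [rosenblattKernel_eq, rosenblattKernel_eq, Prod.fst_swap, Prod.snd_swap,
        erosenblattKernel_comm]
    obtain ⟨⟨i2, m2⟩, i3, m3⟩ :=
      IsDoubleWienerIto.moments hB (measurable_rosenblattKernel A) hsymm hZ
    have h2 : γ 0 + γ 1 + 2 ≠ 0 := by linarith
    refine ⟨⟨i2, ?_⟩, i3, ?_⟩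
    · have h3 : 2 * (γ 0 + γ 1) + 3 ≠ 0 := by linarith
      -- The constants combine to `2 · (A/2)² · 2 · 2 / 2 = A²`; the last 2 is split off from `p +
      -- 1`.
      rw [m2, hL2.2, normConst_eq,
        show 2 * (γ 0 + γ 1) + 3 + 1 = 2 * (γ 0 + γ 1 + 2) by ring]
      field_simp
    · have h3 : 3 * (γ 0 + γ 1) + 5 ≠ 0 := by linarith
      -- Here they combine to `8 · (A/2)³ · 6 / 3 = 2 A³`, the 3 coming from `p + 1`.
      rw [m3, cyclicIntegral_rosenblattKernel A hγ hsum, sum_fin_three_arrow fun a b c : Fin 2 =>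
        beta (γ a + 1) (-γ a - γ c.rev - 1) * beta (γ a.rev + 1) (-γ a.rev - γ b - 1) *
          beta (γ b.rev + 1) (-γ b.rev - γ c - 1) *
          beta (γ a.rev + γ b + 2) (γ b.rev + γ c + 2), ← cyclicConst,
        show 3 * (γ 0 + γ 1) + 5 + 1 = 3 * (γ 0 + γ 1 + 2) by ring]
      field_simp
      ring
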